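/- Let $A$ be a finite-dimensional complex Hilbert space with a fixed orthonormal basis $(|i\rangle)$, let $L(A)$ be its algebra of operators, let $B$ be a copy of $A$, and write $|\Phi\rangle=\sum_i |i\rangle\otimes|i\rangle\in A\otimes B$. Let $S_0\subseteq L(A)$ be a (unital) $C^*$-algebra. A linear subspace $S\subseteq L(A)$ is an *$S_0$-graph* if $S=S^\dagger$, $I\in S$, $S_0\subseteq S$ and $S_0SS_0=S$ (linear span of products); its complement is $S^c=S^\perp+S_0$, where $\perp$ is taken for the Hilbert--Schmidt inner product. For a subspace $S\subseteq L(A)$ and $W\ge 0$ put $$\tilde\vartheta(S,W)=\min\{\lambda\in\mathbb R:\ Y\in S\otimes L(B),\ \operatorname{Tr}_A Y\le\lambda I,\ Y\ge(\sqrt W\otimes I)|\Phi\rangle\langle\Phi|(\sqrt W\otimes I)\}.$$ The theta body of $S$ is $$\mathrm{TH}(S)=\{X\ge 0:\ \operatorname{Tr}(XW)\le 1\text{ for all }W\ge 0\text{ with }\tilde\vartheta(S,W)\le 1\}.$$ The anti-blocker of a set $\mathcal C$ of positive semidefinite operators is $$\mathcal C^\sharp=\{X\ge 0:\ \operatorname{Tr}(XW)\le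 1\text{ for all }W\in\mathcal C\},$$ and $\mathrm{TH}^\sharp(S)$ denotes $\mathrm{TH}(S)^\sharp$. The algebra $S_0$ admits a decomposition $A=\bigoplus_{i=1}^r A_i\otimes Y_i$ (orthogonal direct sum, nonzero factors) with $S_0=\bigoplus_{i=1}^r L(A_i)\otimes I_{Y_i}$. Fix any such decomposition, let $P_i$ be the projector onto $A_i\otimes Y_i$, and define $$\Psi(W)=\sum_{i=1}^r(\dim Y_i)^{-1}\,I_{A_i}\otimes\operatorname{Tr}_{A_i}(P_iWP_i).$$ The $\Psi$-anti-blocker of $\mathcal C$ is $\{W\ge 0:\ \Psi(W)\in\mathcal C\}^\sharp$. **Theorem.** For every $S_0$-graph $S\subseteq L(A)$, $\mathrm{TH}^\sharp(S^c)$ is the $\Psi$-anti-blocker of $\mathrm{TH}^\sharp(S)$: $$\mathrm{TH}^\sharp(S^c)=\{W\ge 0:\ \Psi(W)\in \mathrm{TH}^\sharp(S)\}^\sharp.$$ -/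

import Mathlib

open scoped Matrix ComplexOrder MatrixOrder Kronecker

namespace NCGraph

variable {n : Type*} [Fintype n] [DecidableEq n]

/-! Operators on the finite-dimensional Hilbert space `A` with orthonormal basis indexed by `n` are
the matrices `Matrix n n ℂ`; `0 ≤ X` and `X ≤ Y` refer to the Loewner order. -/

/-- A non-commutative graph: an operator space `S` with `S† = S` and `I ∈ S`. -/
structure IsNCGraph (S : Submodule ℂ (Matrix n n ℂ)) : Prop where
  conjTranspose_mem : ∀ X ∈ S, Xᴴ ∈ S
  one_mem : 1 ∈ S

/-- An `S₀`-graph: a non-commutative graph `S` with `S₀ ⊆ S` and `S₀ S S₀ = S`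
(the product of operator spaces is the span of the products of their elements). -/
structure IsS0Graph (S₀ : StarSubalgebra ℂ (Matrix n n ℂ)) (S : Submodule ℂ (Matrix n n ℂ)) :
    Prop where
  isNCGraph : IsNCGraph S
  le : Subalgebra.toSubmodule S₀.toSubalgebra ≤ S
  bimodule : Subalgebra.toSubmodule S₀.toSubalgebra * S * Subalgebra.toSubmodule S₀.toSubalgebra = S

/-- The orthogonal complement `S^⊥` for the Hilbert-Schmidt inner product `Tr (Y† X)`. -/
def perp (S : Submodule ℂ (Matrix n n ℂ)) : Submodule ℂ (Matrix n n ℂ) where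
  carrier := {X | ∀ Y ∈ S, (Yᴴ * X).trace = 0}
  add_mem' {X X'} hX hX' Y hY := by simp [mul_add, hX Y hY, hX' Y hY]
  zero_mem' Y _ := by simp
  smul_mem' c X hX Y hY := by simp [hX Y hY]

/-- The complement `S^c = S^⊥ + S₀` of an `S₀`-graph. -/
def compl (S₀ : StarSubalgebra ℂ (Matrix n n ℂ)) (S : Submodule ℂ (Matrix n n ℂ)) :
    Submodule ℂ (Matrix n n ℂ) :=
  perp S ⊔ Subalgebra.toSubmodule S₀.toSubalgebra

/-- The space `S ⊗ L(B)`, where `B` is a copy of `A`. -/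
def tensorFull (S : Submodule ℂ (Matrix n n ℂ)) : Submodule ℂ (Matrix (n × n) (n × n) ℂ) :=
  Submodule.span ℂ {Y | ∃ M ∈ S, ∃ N : Matrix n n ℂ, Y = M ⊗ₖ N}

/-- The partial trace over the first tensor factor. -/
def traceLeft {a b : Type*} [Fintype a] (Y : Matrix (a × b) (a × b) ℂ) : Matrix b b ℂ :=
  Matrix.of fun j j' => ∑ i, Y (i, j) (i, j')

/-- The vector `(√W ⊗ I) |Φ⟩` with `|Φ⟩ = ∑ i, |i⟩ ⊗ |i⟩`; its `(i, j)` entry is `(√W) i j`. -/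
noncomputable def sqrtVec (W : Matrix n n ℂ) : n × n → ℂ :=
  (CFC.sqrt W ⊗ₖ (1 : Matrix n n ℂ)) *ᵥ fun x => if x.1 = x.2 then 1 else 0

/-- The weighted theta function `ϑ̃(S, W)` (for `W ≥ 0`): the minimal `λ` for which some
`Y ∈ S ⊗ L(B)` has `Tr_A Y ≤ λ I` and `Y ≥ |√W⟩⟨√W|`. -/
noncomputable def theta (S : Submodule ℂ (Matrix n n ℂ)) (W : Matrix n n ℂ) : ℝ :=
  sInf {l : ℝ | ∃ Y ∈ tensorFull S,
    traceLeft Y ≤ (l : ℂ) • (1 : Matrix n n ℂ) ∧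
    Matrix.vecMulVec (sqrtVec W) (star (sqrtVec W)) ≤ Y}

/-- The anti-blocker `C^♯`. (`Tr (A B)` is real for positive semidefinite `A` and `B`.) -/
def antiblocker (C : Set (Matrix n n ℂ)) : Set (Matrix n n ℂ) :=
  {B | 0 ≤ B ∧ ∀ A ∈ C, (A * B).trace.re ≤ 1}

/-- The theta body `TH(S)`. -/
def thetaBody (S : Submodule ℂ (Matrix n n ℂ)) : Set (Matrix n n ℂ) :=
  {X | 0 ≤ X ∧ ∀ W : Matrix n n ℂ, 0 ≤ W → theta S W ≤ 1 → (X * W).trace.re ≤ 1}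

/-- A decomposition `A = ⨁ i, A_i ⊗ Y_i` (through the unitary `U`), with `p i = dim A_i` and
`q i = dim Y_i`, for which `S₀ = ⨁ i, L(A_i) ⊗ I`. -/
structure BlockDecomposition (S₀ : StarSubalgebra ℂ (Matrix n n ℂ)) where
  r : ℕ
  p : Fin r → ℕ
  q : Fin r → ℕ
  p_pos : ∀ i, 0 < p i
  q_pos : ∀ i, 0 < q i
  U : Matrix (Σ i, Fin (p i) × Fin (q i)) n ℂ
  conjTranspose_mul_self : Uᴴ * U = 1
  mul_conjTranspose_self : U * Uᴴ = 1
  mem_iff : ∀ X, X ∈ S₀ ↔ ∃ M : ∀ i, Matrix (Fin (p i)) (Fin (p i)) ℂ,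
    X = Uᴴ * Matrix.blockDiagonal' (fun i => M i ⊗ₖ (1 : Matrix (Fin (q i)) (Fin (q i)) ℂ)) * U

/-! Existence of block decompositions, so that `Ψ` below is available for every `S₀`. -/

/-- An orthogonal projection onto a subspace, as a matrix. -/
theorem exists_proj (W : Submodule ℂ (n → ℂ)) : ∃ E : Matrix n n ℂ, Eᴴ = E ∧
    (∀ v, E *ᵥ v ∈ W) ∧ (∀ v ∈ W, E *ᵥ v = v) := by
  classical
  let K : Submodule ℂ (EuclideanSpace ℂ n) :=
    W.comap (WithLp.linearEquiv 2 ℂ (n → ℂ)).toLinearMap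
  let Φ := Matrix.toEuclideanCLM (n := n) (𝕜 := ℂ)
  refine ⟨Φ.symm K.starProjection, ?_, fun v => ?_, fun v hv => ?_⟩
  · have h : star K.starProjection = K.starProjection := isSelfAdjoint_starProjection K
    have h2 : Φ.symm (star K.starProjection) = star (Φ.symm K.starProjection) := Φ.symm.map_star' _
    rw [h] at h2
    exact h2.symm
  · have h := Matrix.ofLp_toEuclideanCLM (Φ.symm K.starProjection) (WithLp.toLp 2 v)
    have h1 : Φ (Φ.symm K.starProjection) = K.starProjection := Φ.apply_symm_apply _
    change (Φ (Φ.symm K.starProjection) _).ofLp = _ at h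
    rw [h1] at h
    simp only at h
    rw [← h]
    exact K.starProjection_apply_mem (WithLp.toLp 2 v)
  · have h := Matrix.ofLp_toEuclideanCLM (Φ.symm K.starProjection) (WithLp.toLp 2 v)
    have h1 : Φ (Φ.symm K.starProjection) = K.starProjection := Φ.apply_symm_apply _
    change (Φ (Φ.symm K.starProjection) _).ofLp = _ at h
    rw [h1] at h
    simp only at h
    rw [← h]
    have : K.starProjection (WithLp.toLp 2 v) = WithLp.toLp 2 v :=
      Submodule.starProjection_eq_self_iff.2 hv
    rw [this]

/-- A matrix that commutes with everything that commutes with `S₀` lies in `S₀`. -/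
theorem mem_of_double_commutant (S₀ : StarSubalgebra ℂ (Matrix n n ℂ)) (T : Matrix n n ℂ)
    (hT : ∀ C : Matrix n n ℂ, (∀ a ∈ S₀, a * C = C * a) → T * C = C * T) : T ∈ S₀ := by
  classical
  let A : Submodule ℂ (Matrix n n ℂ) := Subalgebra.toSubmodule S₀.toSubalgebra
  have hA : ∀ x, x ∈ A ↔ x ∈ S₀ := fun x => Iff.rfl
  let B : LinearMap.BilinForm ℂ (Matrix n n ℂ) :=
    (LinearMap.mul ℂ (Matrix n n ℂ)).compr₂ (Matrix.traceLinearMap n ℂ ℂ)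
  have hB : ∀ x y, B x y = (x * y).trace := fun x y => rfl
  have hrefl : B.IsRefl := by
    intro x y h
    rw [hB] at h ⊢
    rw [Matrix.trace_mul_comm, h]
  have hcompl : IsCompl A (B.orthogonal A) := by
    rw [LinearMap.BilinForm.isCompl_orthogonal_iff_disjoint hrefl, Submodule.disjoint_def]
    intro x hx hx'
    have : (star x * x).trace = 0 := hx' (star x) ((hA _).2 (star_mem ((hA x).1 hx)))
    rw [Matrix.star_eq_conjTranspose,
      Matrix.trace_conjTranspose_mul_self_eq_zero_iff] at this
    exact this
  let Q := A.projection (B.orthogonal A) hcompl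
  have hQA : ∀ a ∈ S₀, ∀ x, Q (a * x) = a * Q x := by
    intro a ha x
    have h1 : x = Q x + (x - Q x) := by abel
    have h2 : x - Q x ∈ B.orthogonal A := Submodule.sub_projection_mem hcompl x
    have h3 : a * (x - Q x) ∈ B.orthogonal A := by
      intro y hy
      have h : (y * a * (x - Q x)).trace = 0 := h2 (y * a) (S₀.mul_mem hy ha)
      change (y * (a * (x - Q x))).trace = 0
      rw [← mul_assoc, h]
    have h4 : a * Q x ∈ A := S₀.mul_mem ha (Submodule.projection_apply_mem hcompl x)
    have h5 : Q (a * Q x) = a * Q x := Submodule.projection_apply_left hcompl ⟨_, h4⟩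
    have h6 : Q (a * (x - Q x)) = 0 := (Submodule.projection_apply_eq_zero_iff hcompl).2 h3
    calc Q (a * x) = Q (a * Q x + a * (x - Q x)) := by rw [← mul_add, ← h1]
      _ = _ := by rw [map_add, h5, h6, add_zero]
  -- the blocks of `Q`
  let C : n → n → Matrix n n ℂ := fun k l => Matrix.of fun i j => Q (Matrix.single j l 1) i k
  have hexp : ∀ (a : Matrix n n ℂ) (j l : n),
      a * Matrix.single j l 1 = ∑ m, a m j • Matrix.single m l (1 : ℂ) := by
    intro a j l
    ext i k
    rw [Matrix.sum_apply]
    simp only [Matrix.smul_apply, Matrix.single_apply, Matrix.mul_apply, smul_eq_mul]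
    by_cases hk : l = k <;> simp [hk]
  have key : ∀ a : Matrix n n ℂ,
      (∀ k l, a * C k l = C k l * a) ↔ ∀ j l, Q (a * Matrix.single j l 1) = a * Q (Matrix.single j l 1) := by
    intro a
    have e : ∀ k l i j, (C k l * a) i j = Q (a * Matrix.single j l 1) i k := by
      intro k l i j
      rw [hexp, map_sum, Matrix.sum_apply, Matrix.mul_apply]
      refine Finset.sum_congr rfl fun m _ => ?_
      rw [map_smul, Matrix.smul_apply, smul_eq_mul, mul_comm]
      rfl
    have e' : ∀ k l i j, (a * C k l) i j = (a * Q (Matrix.single j l 1)) i k := by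
      intro k l i j
      rw [Matrix.mul_apply, Matrix.mul_apply]; rfl
    constructor
    · intro h j l
      ext i k
      rw [← e, ← e', h]
    · intro h k l
      ext i j
      rw [e, e', h]
  have hTQ := (key T).1 fun k l => hT _ fun a ha => (key a).2 (fun j l => hQA a ha _) k l
  have hone : (1 : Matrix n n ℂ) = ∑ j, Matrix.single j j 1 := by
    ext i k
    rw [Matrix.sum_apply]
    simp [Matrix.single_apply, Matrix.one_apply, ite_and]
  have h1 : Q 1 = 1 := Submodule.projection_apply_left hcompl ⟨1, S₀.one_mem⟩
  have h2 : Q T = T := by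
    have : Q (T * 1) = T * Q 1 := by
      rw [hone, Finset.mul_sum, map_sum, map_sum, Finset.mul_sum]
      exact Finset.sum_congr rfl fun j _ => hTQ j j
    rwa [h1, mul_one] at this
  rw [← hA, ← h2]
  exact Submodule.projection_apply_mem hcompl T

/-- A projection in the commutant that is not minimal splits. -/
theorem exists_split (S₀ : StarSubalgebra ℂ (Matrix n n ℂ)) (P : Matrix n n ℂ)
    (hP : Pᴴ = P) (hPP : P * P = P) (hPA : ∀ a ∈ S₀, a * P = P * a) (hP0 : P ≠ 0)
    (C : Matrix n n ℂ) (hC : ∀ a ∈ S₀, a * C = C * a) (hne : ∀ c : ℂ, P * C * P ≠ c • P) :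
    ∃ E : Matrix n n ℂ, Eᴴ = E ∧ E * E = E ∧ (∀ a ∈ S₀, a * E = E * a) ∧ P * E = E ∧ E * P = E ∧
      E ≠ 0 ∧ E ≠ P := by
  let V : Submodule ℂ (n → ℂ) := LinearMap.range (Matrix.mulVecLin P)
  have hV : ∀ v, v ∈ V ↔ P *ᵥ v = v := by
    intro v
    constructor
    · rintro ⟨w, rfl⟩
      simp [Matrix.mulVec_mulVec, hPP]
    · intro h; exact ⟨v, h⟩
  have hmaps : ∀ v ∈ V, Matrix.mulVecLin (P * C * P) v ∈ V := by
    intro v _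
    rw [hV]
    simp only [Matrix.mulVecLin_apply, Matrix.mulVec_mulVec]
    rw [← mul_assoc, ← mul_assoc, hPP]
  have : Nontrivial V := by
    rw [Submodule.nontrivial_iff_ne_bot]
    intro h
    apply hP0
    have h2 : P.mulVecLin = 0 := LinearMap.range_eq_bot.1 h
    ext i j
    have := congrFun (LinearMap.congr_fun h2 (Pi.single j 1)) i
    simpa using this
  obtain ⟨c, hc⟩ := Module.End.exists_eigenvalue
    ((Matrix.mulVecLin (P * C * P)).restrict hmaps)
  obtain ⟨x, hx⟩ := hc.exists_hasEigenvector
  have hx1 : (P * C * P) *ᵥ (x : n → ℂ) = c • (x : n → ℂ) := by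
    have := congrArg Subtype.val hx.apply_eq_smul
    simpa [mul_assoc] using this
  have hx0 : (x : n → ℂ) ≠ 0 := fun h => hx.2 (Subtype.ext h)
  let W : Submodule ℂ (n → ℂ) := V ⊓ LinearMap.ker (Matrix.mulVecLin (P * C * P - c • 1))
  have hW : ∀ v, v ∈ W ↔ P *ᵥ v = v ∧ (P * C * P) *ᵥ v = c • v := by
    intro v
    rw [Submodule.mem_inf, hV, LinearMap.mem_ker, Matrix.mulVecLin_apply, Matrix.sub_mulVec,
      sub_eq_zero, Matrix.smul_mulVec, Matrix.one_mulVec]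
  obtain ⟨E, hE1, hE2, hE3⟩ := exists_proj W
  have hext : ∀ X Y : Matrix n n ℂ, (∀ v, X *ᵥ v = Y *ᵥ v) → X = Y := fun X Y h =>
    Matrix.ext_of_mulVec_single fun i => h _
  have hEE : E * E = E := hext _ _ fun v => by
    rw [← Matrix.mulVec_mulVec, hE3 _ (hE2 v)]
  have hPE : P * E = E := hext _ _ fun v => by
    rw [← Matrix.mulVec_mulVec]; exact ((hW _).1 (hE2 v)).1
  have hEP : E * P = E := by
    have := congrArg Matrix.conjTranspose hPE
    rwa [Matrix.conjTranspose_mul, hE1, hP] at this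
  have hinv : ∀ a ∈ S₀, E * a * E = a * E := by
    intro a ha
    refine hext _ _ fun v => ?_
    rw [mul_assoc, ← Matrix.mulVec_mulVec]
    apply hE3
    rw [← Matrix.mulVec_mulVec, hW]
    have hv := (hW _).1 (hE2 v)
    constructor
    · rw [Matrix.mulVec_mulVec, ← hPA a ha, ← Matrix.mulVec_mulVec, hv.1]
    · have : P * C * P * a = a * (P * C * P) := by
        rw [mul_assoc, ← hPA a ha, mul_assoc P C, ← mul_assoc C a, ← hC a ha]
        simp only [← mul_assoc]
        rw [hPA a ha]
      rw [Matrix.mulVec_mulVec, this, ← Matrix.mulVec_mulVec, hv.2, Matrix.mulVec_smul]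
  refine ⟨E, hE1, hEE, fun a ha => ?_, hPE, hEP, ?_, ?_⟩
  · have h1 := congrArg Matrix.conjTranspose (hinv _ (star_mem ha))
    simp only [Matrix.conjTranspose_mul, hE1, Matrix.star_eq_conjTranspose,
      Matrix.conjTranspose_conjTranspose] at h1
    rw [← h1, ← mul_assoc, hinv a ha]
  · rintro rfl
    apply hx0
    have := hE3 x ((hW _).2 ⟨(hV _).1 x.2, hx1⟩)
    rw [← this, Matrix.zero_mulVec]
  · intro hEqP
    apply hne c
    refine hext _ _ fun v => ?_
    have := ((hW _).1 (hE2 v)).2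
    rw [hEqP, Matrix.mulVec_mulVec, mul_assoc, hPP] at this
    rw [this, Matrix.smul_mulVec]

/-- Every projection in the commutant is a sum of orthogonal minimal ones. -/
theorem exists_minimal_projections (S₀ : StarSubalgebra ℂ (Matrix n n ℂ)) (P : Matrix n n ℂ)
    (hP : Pᴴ = P) (hPP : P * P = P) (hPA : ∀ a ∈ S₀, a * P = P * a) :
    ∃ (K : Type) (_ : Fintype K) (_ : DecidableEq K) (R : K → Matrix n n ℂ),
      (∀ k, (R k)ᴴ = R k) ∧ (∀ k l, R k * R l = if k = l then R k else 0) ∧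
      (∀ k, ∀ a ∈ S₀, a * R k = R k * a) ∧ (∀ k, R k ≠ 0) ∧
      (∀ k (C : Matrix n n ℂ), (∀ a ∈ S₀, a * C = C * a) → ∃ c : ℂ, R k * C * R k = c • R k) ∧
      ∑ k, R k = P := by
  suffices h : ∀ (V : Submodule ℂ (n → ℂ)) (P : Matrix n n ℂ), LinearMap.range P.mulVecLin = V →
      Pᴴ = P → P * P = P → (∀ a ∈ S₀, a * P = P * a) →
      ∃ (K : Type) (_ : Fintype K) (_ : DecidableEq K) (R : K → Matrix n n ℂ),
      (∀ k, (R k)ᴴ = R k) ∧ (∀ k l, R k * R l = if k = l then R k else 0) ∧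
      (∀ k, ∀ a ∈ S₀, a * R k = R k * a) ∧ (∀ k, R k ≠ 0) ∧
      (∀ k (C : Matrix n n ℂ), (∀ a ∈ S₀, a * C = C * a) → ∃ c : ℂ, R k * C * R k = c • R k) ∧
      ∑ k, R k = P from h _ P rfl hP hPP hPA
  intro V
  induction V using WellFoundedLT.induction with
  | ind V ih =>
  intro P hV hP hPP hPA
  by_cases hP0 : P = 0
  · exact ⟨Empty, inferInstance, inferInstance, fun k => k.elim, fun k => k.elim, fun k => k.elim,
      fun k => k.elim, fun k => k.elim, fun k => k.elim, by simp [hP0]⟩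
  by_cases hmin : ∀ C : Matrix n n ℂ, (∀ a ∈ S₀, a * C = C * a) → ∃ c : ℂ, P * C * P = c • P
  · exact ⟨Unit, inferInstance, inferInstance, fun _ => P, fun _ => hP, fun _ _ => by simp [hPP],
      fun _ => hPA, fun _ => hP0, fun _ => hmin, by simp⟩
  push Not at hmin
  obtain ⟨C, hC, hne⟩ := hmin
  obtain ⟨E, hE, hEE, hEA, hPE, hEP, hE0, hEneP⟩ := exists_split S₀ P hP hPP hPA hP0 C hC hne
  have hlt : ∀ F : Matrix n n ℂ, P * F = F → F * P = F → F * F = F → F ≠ P →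
      LinearMap.range F.mulVecLin < V := by
    intro F h1 h2 h3 h4
    rw [← hV]
    refine lt_of_le_of_ne ?_ ?_
    · rintro _ ⟨v, rfl⟩
      exact ⟨F *ᵥ v, by simp [Matrix.mulVec_mulVec, h1]⟩
    · intro heq
      apply h4
      rw [← h2]
      refine Matrix.ext_of_mulVec_single fun i => ?_
      obtain ⟨w, hw⟩ : P *ᵥ Pi.single i 1 ∈ LinearMap.range F.mulVecLin := by
        rw [heq]; exact ⟨_, rfl⟩
      rw [Matrix.mulVecLin_apply] at hw
      rw [← Matrix.mulVec_mulVec, ← hw, Matrix.mulVec_mulVec, h3]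
  obtain ⟨K1, _, _, R1, a1, b1, c1, d1, e1, f1⟩ :=
    ih _ (hlt E hPE hEP hEE hEneP) E rfl hE hEE hEA
  have g1 : P * (P - E) = P - E := by rw [mul_sub, hPP, hPE]
  have g2 : (P - E) * P = P - E := by rw [sub_mul, hPP, hEP]
  have g3 : (P - E) * (P - E) = P - E := by rw [mul_sub, g2, sub_mul, hPE, hEE, sub_self, sub_zero]
  obtain ⟨K2, _, _, R2, a2, b2, c2, d2, e2, f2⟩ :=
    ih _ (hlt (P - E) g1 g2 g3 (by simpa using hE0)) (P - E) rfl
      (by rw [Matrix.conjTranspose_sub, hP, hE]) g3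
      (fun a ha => by rw [mul_sub, sub_mul, hPA a ha, hEA a ha])
  have hz : E * (P - E) = 0 := by rw [mul_sub, hEP, hEE, sub_self]
  have hz' : (P - E) * E = 0 := by rw [sub_mul, hPE, hEE, sub_self]
  have h1r : ∀ k, R1 k * E = R1 k := fun k => by simp [← f1, Finset.mul_sum, b1]
  have h1l : ∀ k, E * R1 k = R1 k := fun k => by simp [← f1, Finset.sum_mul, b1]
  have h2r : ∀ k, R2 k * (P - E) = R2 k := fun k => by simp [← f2, Finset.mul_sum, b2]
  have h2l : ∀ k, (P - E) * R2 k = R2 k := fun k => by simp [← f2, Finset.sum_mul, b2]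
  refine ⟨K1 ⊕ K2, inferInstance, inferInstance, Sum.elim R1 R2, ?_, ?_, ?_, ?_, ?_, ?_⟩
  · rintro (k | k) <;> simp [a1, a2]
  · rintro (k | k) (l | l)
    · simp [b1]
    · simp only [Sum.elim_inl, Sum.elim_inr, reduceCtorEq, if_false]
      rw [← h1r, ← h2l, mul_assoc, ← mul_assoc E, hz, zero_mul, mul_zero]
    · simp only [Sum.elim_inl, Sum.elim_inr, reduceCtorEq, if_false]
      rw [← h2r, ← h1l, mul_assoc, ← mul_assoc (P - E), hz', zero_mul, mul_zero]
    · simp [b2]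
  · rintro (k | k)
    · exact c1 k
    · exact c2 k
  · rintro (k | k)
    · exact d1 k
    · exact d2 k
  · rintro (k | k)
    · exact e1 k
    · exact e2 k
  · simp [f1, f2]

/-- An orthogonal projection is `V Vᴴ` for an isometry `V`. -/
theorem exists_isometry (R : Matrix n n ℂ) (hR : Rᴴ = R) (hRR : R * R = R) :
    ∃ (p : ℕ) (V : Matrix n (Fin p) ℂ), Vᴴ * V = 1 ∧ V * Vᴴ = R := by
  let K : Submodule ℂ (EuclideanSpace ℂ n) :=
    (LinearMap.range R.mulVecLin).comap (WithLp.linearEquiv 2 ℂ (n → ℂ)).toLinearMap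
  let b := stdOrthonormalBasis ℂ K
  let V : Matrix n (Fin (Module.finrank ℂ K)) ℂ := Matrix.of fun i j => (b j : EuclideanSpace ℂ n) i
  have hVV : Vᴴ * V = 1 := by
    ext j k
    have h := orthonormal_iff_ite.1 b.orthonormal j k
    rw [Submodule.coe_inner, PiLp.inner_apply] at h
    rw [Matrix.mul_apply, Matrix.one_apply, ← h]
    refine Finset.sum_congr rfl fun i _ => ?_
    simp [V, mul_comm]
  have hRV : R * V = V := by
    ext i j
    obtain ⟨w, hw⟩ : (b j : EuclideanSpace ℂ n).ofLp ∈ LinearMap.range R.mulVecLin := (b j).2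
    have h : R *ᵥ (b j : EuclideanSpace ℂ n).ofLp = (b j : EuclideanSpace ℂ n).ofLp := by
      rw [← hw, Matrix.mulVecLin_apply, Matrix.mulVec_mulVec, hRR]
    exact congrFun h i
  have hVR : V * Vᴴ * R = R := by
    refine Matrix.ext_of_mulVec_single fun i => ?_
    set w : n → ℂ := R *ᵥ Pi.single i 1 with hw
    let w' : K := ⟨WithLp.toLp 2 w, ⟨Pi.single i 1, rfl⟩⟩
    have h : V *ᵥ (fun j => b.repr w' j) = w := by
      have h := congrArg (fun z : K => (z : EuclideanSpace ℂ n).ofLp) (b.sum_repr w')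
      ext x
      have h' := congrFun h x
      simp only [Submodule.coe_sum, Submodule.coe_smul, WithLp.ofLp_sum, Finset.sum_apply,
        PiLp.smul_apply, smul_eq_mul] at h'
      change _ = w x at h'
      rw [← h']
      simp only [Matrix.mulVec, dotProduct]
      exact Finset.sum_congr rfl fun j _ => mul_comm (G := ℂ) _ _
    rw [← Matrix.mulVec_mulVec, ← hw, ← h, Matrix.mulVec_mulVec, Matrix.mul_assoc, hVV, Matrix.mul_one]
  refine ⟨_, V, hVV, ?_⟩
  have h1 := congrArg Matrix.conjTranspose hVR
  rw [Matrix.conjTranspose_mul, Matrix.conjTranspose_mul, Matrix.conjTranspose_conjTranspose, hR,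
    ← Matrix.mul_assoc, hRV] at h1
  exact h1

/-- Two minimal projections linked through the commutant are equivalent in it. -/
theorem exists_partial_isometry (S₀ : StarSubalgebra ℂ (Matrix n n ℂ)) (P R C : Matrix n n ℂ)
    (hP : Pᴴ = P) (hPP : P * P = P) (hPA : ∀ a ∈ S₀, a * P = P * a)
    (hPmin : ∀ C : Matrix n n ℂ, (∀ a ∈ S₀, a * C = C * a) → ∃ c : ℂ, P * C * P = c • P)
    (hR : Rᴴ = R) (hRR : R * R = R) (hRA : ∀ a ∈ S₀, a * R = R * a)
    (hRmin : ∀ C : Matrix n n ℂ, (∀ a ∈ S₀, a * C = C * a) → ∃ c : ℂ, R * C * R = c • R)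
    (hC : ∀ a ∈ S₀, a * C = C * a) (hne : P * C * R ≠ 0) :
    ∃ G : Matrix n n ℂ, (∀ a ∈ S₀, a * G = G * a) ∧ Gᴴ * G = R ∧ G * Gᴴ = P ∧
      P * G = G ∧ G * R = G := by
  have hstar : ∀ X : Matrix n n ℂ, (∀ a ∈ S₀, a * X = X * a) → ∀ a ∈ S₀, a * Xᴴ = Xᴴ * a := by
    intro X hX a ha
    have := congrArg Matrix.conjTranspose (hX _ (star_mem ha))
    simpa [Matrix.star_eq_conjTranspose] using this.symm
  have hmul : ∀ X Y : Matrix n n ℂ, (∀ a ∈ S₀, a * X = X * a) → (∀ a ∈ S₀, a * Y = Y * a) →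
      ∀ a ∈ S₀, a * (X * Y) = X * Y * a := by
    intro X Y hX hY a ha
    rw [← mul_assoc, hX a ha, mul_assoc, hY a ha, mul_assoc]
  set Y := P * C * R with hY
  have hYA : ∀ a ∈ S₀, a * Y = Y * a := hmul _ _ (hmul _ _ hPA hC) hRA
  have hPY : P * Y = Y := by rw [hY, ← mul_assoc, ← mul_assoc, hPP]
  have hYR : Y * R = Y := by rw [hY, mul_assoc, hRR]
  have hRY : R * Yᴴ = Yᴴ := by
    have := congrArg Matrix.conjTranspose hYR
    rwa [Matrix.conjTranspose_mul, hR] at this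
  have hYP : Yᴴ * P = Yᴴ := by
    have := congrArg Matrix.conjTranspose hPY
    rwa [Matrix.conjTranspose_mul, hP] at this
  obtain ⟨c, hc⟩ := hRmin (Yᴴ * Y) (hmul _ _ (hstar _ hYA) hYA)
  rw [← mul_assoc, hRY, mul_assoc, hYR] at hc
  have hpos : ∀ X : Matrix n n ℂ, X ≠ 0 → 0 < (Xᴴ * X).trace := by
    intro X hX
    refine lt_of_le_of_ne (Matrix.posSemidef_conjTranspose_mul_self X).trace_nonneg fun h => hX ?_
    exact Matrix.trace_conjTranspose_mul_self_eq_zero_iff.1 h.symm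
  have hR0 : R ≠ 0 := by
    intro h
    exact hne (by rw [hY, h, mul_zero])
  have h1 := hpos Y hne
  have h2 := hpos R hR0
  rw [hR, hRR] at h2
  rw [hc, Matrix.trace_smul, smul_eq_mul] at h1
  have hcpos : 0 < c := by
    have h2' := h2.ne'
    have : c = c * R.trace * (R.trace)⁻¹ := by field_simp
    rw [this]
    exact mul_pos h1 (by
      rw [Complex.pos_iff] at h2 ⊢
      have him : R.trace = (R.trace.re : ℂ) := Complex.ext rfl h2.2.symm
      rw [him, ← Complex.ofReal_inv]
      exact ⟨by simpa using h2.1, by simp⟩)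
  rw [Complex.pos_iff] at hcpos
  have hcre : c = (c.re : ℂ) := Complex.ext rfl hcpos.2.symm
  set s : ℝ := (Real.sqrt c.re)⁻¹ with hs
  have hs2 : s * s * c.re = 1 := by
    rw [hs, ← mul_inv, Real.mul_self_sqrt hcpos.1.le, inv_mul_cancel₀ hcpos.1.ne']
  set G : Matrix n n ℂ := (s : ℂ) • Y with hG
  have hGA : ∀ a ∈ S₀, a * G = G * a := fun a ha => by
    rw [hG, Matrix.mul_smul, Matrix.smul_mul, hYA a ha]
  have hGG : Gᴴ * G = R := by
    rw [hG, Matrix.conjTranspose_smul, Matrix.smul_mul, Matrix.mul_smul, smul_smul, hc, smul_smul,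
      hcre]
    have : star (s : ℂ) * (s : ℂ) * (c.re : ℂ) = 1 := by
      rw [Complex.star_def, Complex.conj_ofReal]
      exact_mod_cast hs2
    rw [this, one_smul]
  have hPG : P * G = G := by rw [hG, Matrix.mul_smul, hPY]
  have hGP : Gᴴ * P = Gᴴ := by
    have := congrArg Matrix.conjTranspose hPG
    rwa [Matrix.conjTranspose_mul, hP] at this
  have hGR : G * R = G := by rw [hG, Matrix.smul_mul, hYR]
  refine ⟨G, hGA, hGG, ?_, hPG, hGR⟩
  obtain ⟨d, hd⟩ := hPmin (G * Gᴴ) (hmul _ _ hGA (hstar _ hGA))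
  rw [← mul_assoc, hPG, mul_assoc, hGP] at hd
  have hP0 : P ≠ 0 := by
    rintro h
    exact hne (by rw [hY, h, zero_mul, zero_mul])
  have hsq : (G * Gᴴ) * (G * Gᴴ) = G * Gᴴ := by
    rw [mul_assoc, ← mul_assoc Gᴴ, hGG, ← mul_assoc, hGR]
  rw [hd, Matrix.smul_mul, Matrix.mul_smul, hPP, smul_smul] at hsq
  have hdd : d * d = d := smul_left_injective ℂ hP0 hsq
  have hd0 : d ≠ 0 := by
    rintro rfl
    rw [zero_smul, Matrix.self_mul_conjTranspose_eq_zero] at hd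
    rw [hd, mul_zero] at hGG
    exact hR0 hGG.symm
  rw [hd, mul_left_cancel₀ hd0 (hdd.trans (mul_one d).symm), one_smul]

/-- Every `C*`-algebra of operators on `A` has a block decomposition. -/
theorem nonempty_blockDecomposition (S₀ : StarSubalgebra ℂ (Matrix n n ℂ)) :
    Nonempty (BlockDecomposition S₀) := by
  classical
  have hstar : ∀ X : Matrix n n ℂ, (∀ a ∈ S₀, a * X = X * a) → ∀ a ∈ S₀, a * Xᴴ = Xᴴ * a := by
    intro X hX a ha
    have := congrArg Matrix.conjTranspose (hX _ (star_mem ha))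
    simpa [Matrix.star_eq_conjTranspose] using this.symm
  have hmul : ∀ X Y : Matrix n n ℂ, (∀ a ∈ S₀, a * X = X * a) → (∀ a ∈ S₀, a * Y = Y * a) →
      ∀ a ∈ S₀, a * (X * Y) = X * Y * a := by
    intro X Y hX hY a ha
    rw [← mul_assoc, hX a ha, mul_assoc, hY a ha, mul_assoc]
  obtain ⟨K, _, _, R, hR, hRR, hRA, hR0, hmin, hsum⟩ := exists_minimal_projections S₀ 1 (by simp)
    (by simp) (by simp)
  have hRid : ∀ k, R k * R k = R k := fun k => by simp [hRR]
  let rel : K → K → Prop := fun k l => ∃ C : Matrix n n ℂ, (∀ a ∈ S₀, a * C = C * a) ∧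
    R k * C * R l ≠ 0
  have hpi : ∀ k l, rel k l → ∃ G : Matrix n n ℂ, (∀ a ∈ S₀, a * G = G * a) ∧ Gᴴ * G = R l ∧
      G * Gᴴ = R k ∧ R k * G = G ∧ G * R l = G := by
    rintro k l ⟨C, hC, hne⟩
    exact exists_partial_isometry S₀ (R k) (R l) C (hR k) (hRid k) (hRA k) (hmin k) (hR l) (hRid l)
      (hRA l) (hmin l) hC hne
  let st : Setoid K :=
    { r := rel
      iseqv :=
        { refl := fun k => ⟨1, by simp, by rw [mul_one, hRid]; exact hR0 k⟩
          symm := by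
            rintro k l ⟨C, hC, hne⟩
            refine ⟨Cᴴ, hstar _ hC, fun h => hne ?_⟩
            have := congrArg Matrix.conjTranspose h
            simpa [Matrix.conjTranspose_mul, hR, mul_assoc] using this
          trans := by
            intro k l m hkl hlm
            obtain ⟨G, hG, hGG, -, hG1, hG2⟩ := hpi _ _ hkl
            obtain ⟨F, hF, hFF, -, hF1, hF2⟩ := hpi _ _ hlm
            refine ⟨G * F, hmul _ _ hG hF, fun h => hR0 m ?_⟩
            rw [← mul_assoc, hG1, mul_assoc, hF2] at h
            have h3 : Fᴴ * (Gᴴ * (G * F)) = R m := by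
              rw [← mul_assoc Gᴴ, hGG, hF1, hFF]
            rw [← h3, h, mul_zero, mul_zero] } }
  let e : Quotient st ≃ Fin (Fintype.card (Quotient st)) := Fintype.equivFin _
  let r := Fintype.card (Quotient st)
  let cls : K → Fin r := fun k => e (Quotient.mk st k)
  have hcls : ∀ k l, cls k = cls l ↔ rel k l := fun k l => by
    rw [e.injective.eq_iff]
    exact Quotient.eq (r := st)
  let rep : Fin r → K := fun i => (e.symm i).out
  have hrep : ∀ i, cls (rep i) = i := fun i => by simp [cls, rep]
  let q : Fin r → ℕ := fun i => Fintype.card {k // cls k = i}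
  let κ : ∀ i, Fin (q i) ≃ {k // cls k = i} := fun i => (Fintype.equivFin _).symm
  choose p V hVV hVR using fun i => exists_isometry (R (rep i)) (hR _) (hRid _)
  have hG := fun i (b : Fin (q i)) => hpi (κ i b).1 (rep i)
    ((hcls _ _).1 ((κ i b).2.trans (hrep i).symm))
  choose G hGA hGG hGG' hG1 hG2 using hG
  have hVRV : ∀ i, (V i)ᴴ * R (rep i) * V i = 1 := fun i => by
    rw [← hVR, ← Matrix.mul_assoc, hVV, Matrix.one_mul, hVV]
  have horth : ∀ i b j d, (κ i b).1 ≠ (κ j d).1 → (G i b)ᴴ * G j d = 0 := by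
    intro i b j d hne
    have h1 : (G i b)ᴴ * R (κ i b).1 = (G i b)ᴴ := by
      have := congrArg Matrix.conjTranspose (hG1 i b)
      rwa [Matrix.conjTranspose_mul, hR] at this
    rw [← h1, ← hG1 j d, mul_assoc, ← mul_assoc (R _), hRR, if_neg hne, zero_mul, mul_zero]
  have hκ : ∀ i b j, ∀ d : Fin (q j), i ≠ j → (κ i b).1 ≠ (κ j d).1 := by
    intro i b j d hij h
    exact hij ((κ i b).2.symm.trans ((congrArg cls h).trans (κ j d).2))
  let Z : ∀ i, Fin (q i) → Matrix n (Fin (p i)) ℂ := fun i b => G i b * V i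
  let J : Matrix n (Σ i, Fin (p i) × Fin (q i)) ℂ := Matrix.of fun x s => Z s.1 s.2.2 x s.2.1
  have hJX : ∀ (X : Matrix n n ℂ) i a b j c d, (Jᴴ * X * J) ⟨i, (a, b)⟩ ⟨j, (c, d)⟩ =
      ((V i)ᴴ * ((G i b)ᴴ * X * G j d) * V j) a c := by
    intro X i a b j c d
    have : (V i)ᴴ * ((G i b)ᴴ * X * G j d) * V j = (Z i b)ᴴ * X * Z j d := by
      simp only [Z, Matrix.conjTranspose_mul, Matrix.mul_assoc]
    rw [this]
    rfl
  have hJJ : Jᴴ * J = 1 := by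
    ext ⟨i, a, b⟩ ⟨j, c, d⟩
    have h := hJX 1 i a b j c d
    rw [Matrix.mul_one] at h
    rw [h, mul_one, Matrix.one_apply]
    by_cases hij : i = j
    · subst hij
      by_cases hbd : b = d
      · subst hbd
        rw [hGG, hVRV, Matrix.one_apply]
        simp
      · rw [horth _ _ _ _ fun h => hbd ((κ i).injective (Subtype.ext h))]
        simp [hbd]
    · rw [horth _ _ _ _ (hκ i b j d hij)]
      simp [hij]
  have hJJ' : J * Jᴴ = 1 := by
    have h1 : J * Jᴴ = ∑ i, ∑ b, Z i b * (Z i b)ᴴ := by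
      ext x y
      rw [Matrix.mul_apply, Fintype.sum_sigma, Matrix.sum_apply]
      refine Finset.sum_congr rfl fun i _ => ?_
      rw [Fintype.sum_prod_type_right, Matrix.sum_apply]
      refine Finset.sum_congr rfl fun b _ => ?_
      rw [Matrix.mul_apply]
      rfl
    have h2 : ∀ i b, Z i b * (Z i b)ᴴ = R (κ i b).1 := by
      intro i b
      have : Z i b * (Z i b)ᴴ = G i b * (V i * (V i)ᴴ) * (G i b)ᴴ := by
        simp only [Z, Matrix.conjTranspose_mul, Matrix.mul_assoc]
      rw [this, hVR, hG2, hGG']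
    rw [h1, ← hsum]
    simp_rw [h2]
    rw [← (Equiv.sigmaFiberEquiv cls).sum_comp, Fintype.sum_sigma]
    refine Finset.sum_congr rfl fun i _ => ?_
    rw [(κ i).sum_comp (fun k => R k.1)]
    rfl
  have hconj : ∀ X : Matrix n n ℂ, X = J * (Jᴴ * X * J) * Jᴴ := by
    intro X
    calc X = (J * Jᴴ) * X * (J * Jᴴ) := by rw [hJJ', one_mul, mul_one]
      _ = _ := by simp only [Matrix.mul_assoc]
  refine ⟨⟨r, p, q, ?_, ?_, Jᴴ, ?_, ?_, ?_⟩⟩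
  · intro i
    rw [Nat.pos_iff_ne_zero]
    intro hp
    apply hR0 (rep i)
    have : IsEmpty (Fin (p i)) := by rw [hp]; infer_instance
    rw [← hVR]
    ext x y
    simp [Matrix.mul_apply]
  · intro i
    exact Fintype.card_pos_iff.2 ⟨⟨rep i, hrep i⟩⟩
  · rw [Matrix.conjTranspose_conjTranspose, hJJ']
  · rw [Matrix.conjTranspose_conjTranspose, hJJ]
  intro X
  rw [Matrix.conjTranspose_conjTranspose]
  constructor
  · intro hX
    refine ⟨fun i => (V i)ᴴ * X * V i, ?_⟩
    have hkey : Jᴴ * X * J = Matrix.blockDiagonal' (fun i => ((V i)ᴴ * X * V i) ⊗ₖ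
        (1 : Matrix (Fin (q i)) (Fin (q i)) ℂ)) := by
      ext ⟨i, a, b⟩ ⟨j, c, d⟩
      rw [hJX, ← hstar _ (hGA i b) X hX, mul_assoc X]
      by_cases hij : i = j
      · subst hij
        rw [Matrix.blockDiagonal'_apply_eq, Matrix.kroneckerMap_apply, Matrix.one_apply]
        by_cases hbd : b = d
        · subst hbd
          rw [hGG, ← hVR, ← Matrix.mul_assoc, ← Matrix.mul_assoc, Matrix.mul_assoc _ _ (V i), hVV]
          simp
        · rw [horth _ _ _ _ fun h => hbd ((κ i).injective (Subtype.ext h))]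
          simp [hbd]
      · rw [horth _ _ _ _ (hκ i b j d hij), Matrix.blockDiagonal'_apply_ne _ _ _ hij]
        simp
    rw [← hkey]
    exact hconj X
  · rintro ⟨M, rfl⟩
    apply mem_of_double_commutant
    intro C hC
    have hc : ∀ i b d, ∃ c : ℂ, (G i b)ᴴ * C * G i d = c • R (rep i) := by
      intro i b d
      obtain ⟨c, hc⟩ := hmin (rep i) ((G i b)ᴴ * C * G i d)
        (hmul _ _ (hmul _ _ (hstar _ (hGA i b)) hC) (hGA i d))
      refine ⟨c, ?_⟩
      have h1 : R (rep i) * (G i b)ᴴ = (G i b)ᴴ := by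
        have := congrArg Matrix.conjTranspose (hG2 i b)
        rwa [Matrix.conjTranspose_mul, hR] at this
      rw [← hc, mul_assoc _ _ (R _), mul_assoc _ _ (R _), hG2, ← mul_assoc, ← mul_assoc, h1]
    choose c hc using hc
    have hN : Jᴴ * C * J = Matrix.blockDiagonal' (fun i =>
        (1 : Matrix (Fin (p i)) (Fin (p i)) ℂ) ⊗ₖ Matrix.of (c i)) := by
      ext ⟨i, a, b⟩ ⟨j, a', d⟩
      rw [hJX]
      by_cases hij : i = j
      · subst hij
        rw [Matrix.blockDiagonal'_apply_eq, Matrix.kroneckerMap_apply, hc, Matrix.mul_smul,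
          Matrix.smul_mul, hVRV, Matrix.smul_apply, smul_eq_mul, mul_comm]
        rfl
      · rw [Matrix.blockDiagonal'_apply_ne _ _ _ hij]
        have h0 : (G i b)ᴴ * C * G j d = 0 := by
          by_contra hne
          apply hij
          rw [← hrep i, ← hrep j, hcls]
          refine ⟨(G i b)ᴴ * C * G j d,
            hmul _ _ (hmul _ _ (hstar _ (hGA i b)) hC) (hGA j d), ?_⟩
          have h1 : R (rep i) * (G i b)ᴴ = (G i b)ᴴ := by
            have := congrArg Matrix.conjTranspose (hG2 i b)
            rwa [Matrix.conjTranspose_mul, hR] at this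
          rwa [mul_assoc _ _ (R _), mul_assoc _ _ (R _), hG2, ← mul_assoc, ← mul_assoc, h1]
        rw [h0]
        simp
    have hcomm : ∀ B N : Matrix (Σ i, Fin (p i) × Fin (q i)) (Σ i, Fin (p i) × Fin (q i)) ℂ,
        B * N = N * B → Jᴴ * C * J = N → J * B * Jᴴ * C = C * (J * B * Jᴴ) := by
      intro B N hBN hCN
      have h1 : C = J * N * Jᴴ := by rw [← hCN]; exact hconj C
      calc J * B * Jᴴ * C = J * B * (Jᴴ * J) * N * Jᴴ := by
            rw [h1]; simp only [Matrix.mul_assoc]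
        _ = J * (B * N) * Jᴴ := by rw [hJJ, Matrix.mul_one]; simp only [Matrix.mul_assoc]
        _ = J * N * (Jᴴ * J) * B * Jᴴ := by
            rw [hJJ, hBN, Matrix.mul_one]; simp only [Matrix.mul_assoc]
        _ = C * (J * B * Jᴴ) := by rw [h1]; simp only [Matrix.mul_assoc]
    refine hcomm _ _ ?_ hN
    rw [← Matrix.blockDiagonal'_mul, ← Matrix.blockDiagonal'_mul]
    congr 1
    funext i
    rw [← Matrix.mul_kronecker_mul, ← Matrix.mul_kronecker_mul]
    simp

/-- The map `Ψ(W) = ∑ i, (dim Y_i)⁻¹ I ⊗ Tr_{A_i} (P_i W P_i)`, where `P_i` is the projector onto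
`A_i ⊗ Y_i`. -/
noncomputable def BlockDecomposition.Psi {S₀ : StarSubalgebra ℂ (Matrix n n ℂ)}
    (d : BlockDecomposition S₀) (W : Matrix n n ℂ) : Matrix n n ℂ :=
  d.Uᴴ * Matrix.blockDiagonal' (fun i => ((d.q i : ℂ)⁻¹) •
    ((1 : Matrix (Fin (d.p i)) (Fin (d.p i)) ℂ) ⊗ₖ
      traceLeft (Matrix.blockDiag' (d.U * W * d.Uᴴ) i))) * d.U

/-- The `Ψ`-anti-blocker `{W ≥ 0 : Ψ(W) ∈ C}^♯` of `C`. -/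
def BlockDecomposition.psiAntiblocker {S₀ : StarSubalgebra ℂ (Matrix n n ℂ)}
    (d : BlockDecomposition S₀) (C : Set (Matrix n n ℂ)) : Set (Matrix n n ℂ) :=
  antiblocker {W | 0 ≤ W ∧ d.Psi W ∈ C}

end NCGraph

namespace NCGraph

/-! ### Positive semidefinite matrices -/

/-! Write ϑ for `theta`. The theorem rests on one identity, `setOf_theta_compl_le_one`: the W' ≥ 0
with ϑ(S^c, W') ≤ 1 form the anti-blocker of the W ≥ 0 with ϑ(S, Ψ(W)) ≤ 1. Applied to S^c, and
since (S^c)^c = S (`compl_compl`), it shows that the sublevel set of ϑ(S, ·) is an anti-blocker.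
Hence it equals its own double anti-blocker, and that is TH^♯(S) (`antiblocker_thetaBody`). After
this substitution for S and for S^c the theorem is the identity itself.

Ψ has Kraus operators q^{-1/2} u, where u runs over the matrix units of S₀; they are a
Hilbert–Schmidt orthonormal basis of S₀. So Ψ(M Mᴴ) is the Gram matrix of `lift M`, whose blocks are
these operators times M. Feasibility at a value l ≥ 0 depends only on the Gram matrix
(`IsFeasible.congr`), so B may be replaced by any auxiliary space, and multiplying slices by
elements of S₀ stays inside S.

One inclusion is the bound Tr(W W') ≤ ϑ(S^c, W') ϑ(S, Ψ(W)), obtained from `trace_mul_re_le`. Given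
feasible Y₁ for S^c and Y₂ for S, compress both to the same space and look at the trace of their
product. From below it is at least Tr(W W')². From above, S^c = S^⊥ + S₀ means that only the
S₀-component of Y₁ pairs with Y₂, and that component is controlled by the two partial traces
(`trace_amp_mul_le`).

For the other inclusion (`exists_one_lt_trace`), let ϑ(S^c, W') > 1. Hahn–Banach (`exists_dual`)
gives Z, ρ ≥ 0 with Z - I ⊗ ρ in (S^c)^⊥ ⊗ L(B) and Tr ρ < ⟨√W'|Z|√W'⟩. Rescaling by ρ^{-1/2} turns
Z into I + T with T over (S^c)^⊥, which lies in S and is orthogonal to S₀. Amplifying I + T by the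
Kraus operators gives an operator over S with partial trace exactly I (`isFeasible_lift`). The
rank-one part of I + T along the rescaled √W' then yields W with ϑ(S, Ψ(W)) ≤ 1 and, by
Cauchy–Schwarz, Tr(W W') > 1. -/

/-- A Hermitian generalized inverse of a Hermitian matrix. -/
theorem exists_hermitian_inverse {n : Type*} [Fintype n] {W : Matrix n n ℂ} (hW : W.IsHermitian) :
    ∃ G : Matrix n n ℂ, Gᴴ = G ∧ W * G * W = W ∧ G * W * G = G := by
  classical
  let φ := Unitary.conjStarAlgAut ℂ (Matrix n n ℂ) hW.eigenvectorUnitary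
  let D : Matrix n n ℂ := Matrix.diagonal (RCLike.ofReal ∘ hW.eigenvalues)
  -- The convention `0⁻¹ = 0` makes this the Moore–Penrose inverse of `D`; zero eigenvalues need no
  -- exclusion.
  let E : Matrix n n ℂ := Matrix.diagonal fun i => ((hW.eigenvalues i)⁻¹ : ℝ)
  have hWφ : W = φ D := hW.spectral_theorem
  have hE : star E = E := by
    rw [Matrix.star_eq_conjTranspose, Matrix.diagonal_conjTranspose]
    congr 1
    funext i
    simp
  have h1 : D * E * D = D := by
    simp only [D, E, Matrix.diagonal_mul_diagonal]
    congr 1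
    funext i
    by_cases h : hW.eigenvalues i = 0 <;> simp [h]
  have h2 : E * D * E = E := by
    simp only [D, E, Matrix.diagonal_mul_diagonal]
    congr 1
    funext i
    by_cases h : hW.eigenvalues i = 0 <;> simp [h]
  refine ⟨φ E, ?_, ?_, ?_⟩
  · rw [← Matrix.star_eq_conjTranspose, ← map_star, hE]
  · rw [hWφ, ← map_mul, ← map_mul, h1]
  · rw [hWφ, ← map_mul, ← map_mul, h2]

/-- Two square roots of the same positive operator differ by a contraction. -/
theorem exists_contraction {n b b' : Type*} [Fintype n] [Fintype b] [Fintype b'] [DecidableEq b']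
    {M : Matrix n b ℂ} {N : Matrix n b' ℂ} (h : N * Nᴴ = M * Mᴴ) :
    ∃ C : Matrix b b' ℂ, N = M * C ∧ (1 - Cᴴ * C).PosSemidef := by
  classical
  obtain ⟨G, hG, hWG, hGW⟩ :=
    exists_hermitian_inverse (Matrix.isHermitian_mul_conjTranspose_self M)
  -- With W = M Mᴴ = N Nᴴ, the product of (1 - W G) N with its adjoint contains W (1 - G W) = 0; so
  -- N has its range inside that of W.
  have hN : (1 - M * Mᴴ * G) * N = 0 := by
    rw [← Matrix.self_mul_conjTranspose_eq_zero, Matrix.conjTranspose_mul, Matrix.conjTranspose_sub,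
      Matrix.conjTranspose_mul, hG, Matrix.conjTranspose_mul, Matrix.conjTranspose_conjTranspose,
      Matrix.conjTranspose_one, Matrix.mul_assoc, ← Matrix.mul_assoc N, h]
    have : M * Mᴴ * (1 - G * (M * Mᴴ)) = 0 := by
      rw [Matrix.mul_sub, Matrix.mul_one, ← Matrix.mul_assoc, hWG, sub_self]
    rw [this, Matrix.mul_zero]
  have hN' : M * Mᴴ * G * N = N := by
    rw [Matrix.sub_mul, Matrix.one_mul, sub_eq_zero] at hN
    exact hN.symm
  refine ⟨Mᴴ * G * N, ?_, ?_⟩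
  · rw [← Matrix.mul_assoc, ← Matrix.mul_assoc, hN']
  · have hC : (Mᴴ * G * N)ᴴ * (Mᴴ * G * N) = Nᴴ * G * N := by
      calc (Mᴴ * G * N)ᴴ * (Mᴴ * G * N) = Nᴴ * (G * (M * Mᴴ) * G) * N := by
            simp only [Matrix.conjTranspose_mul, hG, Matrix.conjTranspose_conjTranspose,
              Matrix.mul_assoc]
        _ = _ := by rw [hGW]
    -- Nᴴ G N is an orthogonal projection, hence so is its complement, which is therefore positive.
    have hidem : (1 - Nᴴ * G * N)ᴴ * (1 - Nᴴ * G * N) = 1 - Nᴴ * G * N := by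
      have h1 : (Nᴴ * G * N)ᴴ = Nᴴ * G * N := by
        simp only [Matrix.conjTranspose_mul, hG, Matrix.conjTranspose_conjTranspose,
          Matrix.mul_assoc]
      have h2 : Nᴴ * G * N * (Nᴴ * G * N) = Nᴴ * G * N := by
        calc Nᴴ * G * N * (Nᴴ * G * N) = Nᴴ * (G * (N * Nᴴ) * G) * N := by
              simp only [Matrix.mul_assoc]
          _ = _ := by rw [h, hGW]
      rw [Matrix.conjTranspose_sub, h1, Matrix.conjTranspose_one, Matrix.sub_mul, Matrix.mul_sub,
        Matrix.mul_sub, h2]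
      simp
    rw [hC, ← hidem]
    exact Matrix.posSemidef_conjTranspose_mul_self _

theorem mul_vecMulVec_mul_conjTranspose {m m' : Type*} [Fintype m] (K : Matrix m' m ℂ)
    (v : m → ℂ) : K * Matrix.vecMulVec v (star v) * Kᴴ =
      Matrix.vecMulVec (K *ᵥ v) (star (K *ᵥ v)) := by
  rw [Matrix.mul_vecMulVec, Matrix.vecMulVec_mul, Matrix.star_mulVec]

theorem trace_mul_nonneg {m : Type*} [Fintype m] {X Y : Matrix m m ℂ} (hX : X.PosSemidef)
    (hY : Y.PosSemidef) : 0 ≤ (X * Y).trace := by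
  classical
  obtain ⟨B, rfl⟩ := CStarAlgebra.nonneg_iff_eq_star_mul_self.mp hX.nonneg
  rw [Matrix.star_eq_conjTranspose, Matrix.mul_assoc, Matrix.trace_mul_comm]
  exact (hY.mul_mul_conjTranspose_same B).trace_nonneg

/-- The part of a positive semidefinite form along a vector is dominated by the form. -/
theorem posSemidef_sub_vecMulVec {m : Type*} [Fintype m] {Z : Matrix m m ℂ} (hZ : Z.PosSemidef)
    (v : m → ℂ) {t : ℝ} (ht : star v ⬝ᵥ (Z *ᵥ v) = t) (ht0 : 0 < t) :
    (Z - Matrix.vecMulVec (((√t)⁻¹ : ℂ) • (Z *ᵥ v)) (star (((√t)⁻¹ : ℂ) • (Z *ᵥ v)))).PosSemidef := by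
  classical
  have ht' : (t : ℂ) ≠ 0 := by exact_mod_cast ht0.ne'
  have hsq : ((√t)⁻¹ : ℂ) * ((√t)⁻¹ : ℂ) = (t : ℂ)⁻¹ := by
    rw [← mul_inv]
    congr 1
    exact_mod_cast Real.mul_self_sqrt ht0.le
  -- Conjugating Z by 1 - t⁻¹ |v⟩⟨Zv| gives two cross terms -t⁻¹ |Zv⟩⟨Zv| and one quadratic term
  -- +t⁻¹ |Zv⟩⟨Zv|, which leaves the required difference.
  have h := hZ.conjTranspose_mul_mul_same
    (1 - (t : ℂ)⁻¹ • Matrix.vecMulVec v (star (Z *ᵥ v)))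
  have hv : star (Z *ᵥ v) = star v ᵥ* Z := by rw [Matrix.star_mulVec, hZ.1]
  convert h using 1
  have h1 : (Matrix.vecMulVec v (star (Z *ᵥ v)))ᴴ = Matrix.vecMulVec (Z *ᵥ v) (star v) := by
    rw [Matrix.conjTranspose_vecMulVec, star_star]
  have h2 : Z * Matrix.vecMulVec v (star (Z *ᵥ v)) =
      Matrix.vecMulVec (Z *ᵥ v) (star (Z *ᵥ v)) := by rw [Matrix.mul_vecMulVec]
  have h3 : Matrix.vecMulVec (Z *ᵥ v) (star v) * Z =
      Matrix.vecMulVec (Z *ᵥ v) (star (Z *ᵥ v)) := by rw [Matrix.vecMulVec_mul, hv]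
  have h4 : Matrix.vecMulVec (Z *ᵥ v) (star (Z *ᵥ v)) * Matrix.vecMulVec v (star (Z *ᵥ v)) =
      (t : ℂ) • Matrix.vecMulVec (Z *ᵥ v) (star (Z *ᵥ v)) := by
    rw [Matrix.vecMulVec_mul_vecMulVec, hv, ← Matrix.dotProduct_mulVec, ht]
    ext; simp [Matrix.vecMulVec_apply, mul_left_comm]
  have h5 : Matrix.vecMulVec (((√t)⁻¹ : ℂ) • (Z *ᵥ v)) (star (((√t)⁻¹ : ℂ) • (Z *ᵥ v))) =
      (t : ℂ)⁻¹ • Matrix.vecMulVec (Z *ᵥ v) (star (Z *ᵥ v)) := by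
    rw [← hsq]
    ext i j
    simp [Matrix.vecMulVec_apply]
    ring
  have hs : star (t : ℂ)⁻¹ = (t : ℂ)⁻¹ := by simp
  rw [h5, Matrix.conjTranspose_sub, Matrix.conjTranspose_smul, h1, Matrix.conjTranspose_one, hs]
  simp only [Matrix.sub_mul, Matrix.mul_sub, Matrix.one_mul, Matrix.mul_one, Matrix.smul_mul,
    Matrix.mul_smul, h2, h3, h4, smul_smul, inv_mul_cancel₀ ht']
  simp

/-! ### Slices of operators on a tensor product -/

/-- The block `(c, c')` of an operator between tensor products with first factor `A`. -/
def slice {n b b' : Type*} (Y : Matrix (n × b) (n × b') ℂ) (c : b) (c' : b') : Matrix n n ℂ :=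
  Matrix.of fun x y => Y (x, c) (y, c')

/-- The vector of `A ⊗ B` with coefficient matrix `M`. -/
def tensorVec {n b : Type*} (M : Matrix n b ℂ) : n × b → ℂ := fun x => M x.1 x.2

/-- The operator `∑ k, g k ⊗ |k⟩ ⊗ I` from `A ⊗ B` to `A ⊗ K ⊗ B`. -/
def amp {n κ : Type*} (b : Type*) [DecidableEq b] (g : κ → Matrix n n ℂ) :
    Matrix (n × (κ × b)) (n × b) ℂ :=
  Matrix.of fun x y => if x.2.2 = y.2 then g x.2.1 x.1 y.1 else 0

section slices

variable {n b b' κ : Type*}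

@[simp] theorem slice_apply (Y : Matrix (n × b) (n × b') ℂ) (c : b) (c' : b') (x y : n) :
    slice Y c c' x y = Y (x, c) (y, c') := rfl

theorem slice_sub (Y Z : Matrix (n × b) (n × b') ℂ) (c : b) (c' : b') :
    slice (Y - Z) c c' = slice Y c c' - slice Z c c' := rfl

theorem slice_smul {R : Type*} [SMul R ℂ] (r : R) (Y : Matrix (n × b) (n × b') ℂ) (c : b) (c' : b') :
    slice (r • Y) c c' = r • slice Y c c' := rfl

theorem slice_ext {Y Z : Matrix (n × b) (n × b') ℂ} (h : ∀ c c', slice Y c c' = slice Z c c') :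
    Y = Z := by
  ext ⟨x, c⟩ ⟨y, c'⟩
  exact congrFun (congrFun (h c c') x) y

theorem slice_kronecker (X : Matrix n n ℂ) (N : Matrix b b' ℂ) (c : b) (c' : b') :
    slice (X ⊗ₖ N) c c' = N c c' • X := by
  ext x y
  simp [mul_comm]

variable [Fintype n]

theorem traceLeft_apply (Y : Matrix (n × b) (n × b) ℂ) (c c' : b) :
    traceLeft Y c c' = (slice Y c c').trace := rfl

theorem traceLeft_sub (Y Z : Matrix (n × b) (n × b) ℂ) :
    traceLeft (Y - Z) = traceLeft Y - traceLeft Z := by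
  ext; simp [traceLeft]

theorem traceLeft_add (Y Z : Matrix (n × b) (n × b) ℂ) :
    traceLeft (Y + Z) = traceLeft Y + traceLeft Z := by
  ext; simp [traceLeft, Finset.sum_add_distrib]

theorem traceLeft_smul (r : ℂ) (Y : Matrix (n × b) (n × b) ℂ) :
    traceLeft (r • Y) = r • traceLeft Y := by
  ext; simp [traceLeft, Finset.mul_sum]

theorem traceLeft_conjTranspose (Y : Matrix (n × b) (n × b) ℂ) :
    traceLeft Yᴴ = (traceLeft Y)ᴴ := by
  ext; simp [traceLeft]

theorem traceLeft_kronecker (X : Matrix n n ℂ) (N : Matrix b b ℂ) :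
    traceLeft (X ⊗ₖ N) = X.trace • N := by
  ext c c'
  rw [traceLeft_apply, slice_kronecker, Matrix.trace_smul, Matrix.smul_apply, smul_eq_mul,
    smul_eq_mul, mul_comm]

theorem trace_traceLeft [Fintype b] (Y : Matrix (n × b) (n × b) ℂ) :
    (traceLeft Y).trace = Y.trace := by
  simp only [Matrix.trace, Matrix.diag_apply, traceLeft, Matrix.of_apply, Fintype.sum_prod_type]
  exact Finset.sum_comm

theorem trace_mul_eq_sum_slice [Fintype b] [Fintype b'] (Y : Matrix (n × b) (n × b') ℂ)
    (Z : Matrix (n × b') (n × b) ℂ) :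
    (Y * Z).trace = ∑ c, ∑ c', (slice Y c c' * slice Z c' c).trace := by
  have h : ∀ c, ∑ c', (slice Y c c' * slice Z c' c).trace = ∑ x, (Y * Z) (x, c) (x, c) := by
    intro c
    simp only [Matrix.trace, Matrix.diag_apply, Matrix.mul_apply, slice_apply,
      Fintype.sum_prod_type]
    rw [Finset.sum_comm]
    exact Finset.sum_congr rfl fun x _ => Finset.sum_comm
  simp_rw [h]
  rw [Matrix.trace, Fintype.sum_prod_type]
  exact Finset.sum_comm

theorem posSemidef_traceLeft {Y : Matrix (n × b) (n × b) ℂ} (hY : Y.PosSemidef) :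
    (traceLeft Y).PosSemidef := by
  have : traceLeft Y = ∑ x, Y.submatrix (fun c => (x, c)) (fun c => (x, c)) := by
    ext c c'
    simp [traceLeft, Matrix.sum_apply]
  rw [this]
  exact Matrix.posSemidef_sum _ fun x _ => hY.submatrix _

theorem trace_one_kronecker_mul [Fintype b] [DecidableEq n] (N : Matrix b b ℂ)
    (Y : Matrix (n × b) (n × b) ℂ) :
    (((1 : Matrix n n ℂ) ⊗ₖ N) * Y).trace = (N * traceLeft Y).trace := by
  rw [trace_mul_eq_sum_slice, Matrix.trace]
  refine Finset.sum_congr rfl fun c _ => ?_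
  rw [Matrix.diag_apply, Matrix.mul_apply]
  refine Finset.sum_congr rfl fun c' _ => ?_
  rw [slice_kronecker, Matrix.smul_mul, Matrix.one_mul, Matrix.trace_smul, traceLeft_apply,
    smul_eq_mul]

theorem slice_one_kronecker_mul [Fintype b] [DecidableEq n] {a : Type*} (C : Matrix a b ℂ)
    (Y : Matrix (n × b) (n × b') ℂ) (c : a) (c' : b') :
    slice (((1 : Matrix n n ℂ) ⊗ₖ C) * Y) c c' = ∑ e, C c e • slice Y e c' := by
  ext x y
  simp [Matrix.mul_apply, Fintype.sum_prod_type, Matrix.sum_apply, Matrix.one_apply, ite_mul,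
    Finset.sum_ite_eq]

theorem slice_mul_one_kronecker [Fintype b'] [DecidableEq n] {a : Type*} (D : Matrix b' a ℂ)
    (Y : Matrix (n × b) (n × b') ℂ) (c : b) (c' : a) :
    slice (Y * ((1 : Matrix n n ℂ) ⊗ₖ D)) c c' = ∑ e, D e c' • slice Y c e := by
  ext x y
  simp [Matrix.mul_apply, Fintype.sum_prod_type, Matrix.sum_apply, Matrix.one_apply, mul_comm]

theorem slice_conj_one_kronecker_mem [Fintype b] [Fintype b'] [DecidableEq n]
    {a a' : Type*} {S : Submodule ℂ (Matrix n n ℂ)}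
    (C : Matrix a b ℂ) (D : Matrix b' a' ℂ)
    {Y : Matrix (n × b) (n × b') ℂ} (hY : ∀ c c', slice Y c c' ∈ S) (c : a) (c' : a') :
    slice (((1 : Matrix n n ℂ) ⊗ₖ C) * Y * ((1 : Matrix n n ℂ) ⊗ₖ D)) c c' ∈ S := by
  rw [slice_mul_one_kronecker]
  refine Submodule.sum_mem _ fun e _ => Submodule.smul_mem _ _ ?_
  rw [slice_one_kronecker_mul]
  exact Submodule.sum_mem _ fun e _ => Submodule.smul_mem _ _ (hY _ _)

theorem traceLeft_conj_one_kronecker [Fintype b] [DecidableEq n] {a : Type*} (C : Matrix a b ℂ)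
    (D : Matrix b a ℂ) (Y : Matrix (n × b) (n × b) ℂ) :
    traceLeft (((1 : Matrix n n ℂ) ⊗ₖ C) * Y * ((1 : Matrix n n ℂ) ⊗ₖ D)) =
      C * traceLeft Y * D := by
  ext c c'
  rw [traceLeft_apply, slice_mul_one_kronecker, Matrix.trace_sum, Matrix.mul_apply]
  refine Finset.sum_congr rfl fun e _ => ?_
  rw [slice_one_kronecker_mul, Matrix.trace_smul, Matrix.trace_sum, Matrix.mul_apply, smul_eq_mul,
    mul_comm]
  congr 1
  refine Finset.sum_congr rfl fun e' _ => ?_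
  rw [Matrix.trace_smul, smul_eq_mul, traceLeft_apply]

theorem one_kronecker_mulVec_tensorVec [Fintype b] [DecidableEq n] {a : Type*} (C : Matrix a b ℂ)
    (M : Matrix n b ℂ) : ((1 : Matrix n n ℂ) ⊗ₖ C) *ᵥ tensorVec M = tensorVec (M * Cᵀ) := by
  ext ⟨x, c⟩
  simp [Matrix.mulVec, dotProduct, tensorVec, Matrix.mul_apply, Fintype.sum_prod_type,
    Matrix.one_apply, mul_comm]

theorem star_tensorVec_dotProduct [Fintype b] (M N : Matrix n b ℂ) :
    star (tensorVec M) ⬝ᵥ tensorVec N = (Mᴴ * N).trace := by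
  simp only [dotProduct, tensorVec, Matrix.trace, Matrix.diag_apply, Matrix.mul_apply,
    Fintype.sum_prod_type, Matrix.conjTranspose_apply, Pi.star_apply]
  exact Finset.sum_comm

theorem slice_amp_mul [Fintype b] [DecidableEq b] (g : κ → Matrix n n ℂ) (Y : Matrix (n × b) (n × b') ℂ)
    (k : κ) (c : b) (c' : b') :
    slice (amp b g * Y) (k, c) c' = g k * slice Y c c' := by
  ext x y
  simp [amp, Matrix.mul_apply, Fintype.sum_prod_type, ite_mul]

theorem slice_mul_amp_conjTranspose [Fintype b'] [DecidableEq b'] (g : κ → Matrix n n ℂ)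
    (Y : Matrix (n × b) (n × b') ℂ) (c : b) (k : κ) (c' : b') :
    slice (Y * (amp b' g)ᴴ) c (k, c') = slice Y c c' * (g k)ᴴ := by
  ext x y
  simp [amp, Matrix.mul_apply, Fintype.sum_prod_type, apply_ite star]

theorem slice_mul_amp [Fintype b'] [Fintype κ] [DecidableEq b'] (g : κ → Matrix n n ℂ)
    (Y : Matrix (n × b) (n × (κ × b')) ℂ) (c : b) (c' : b') :
    slice (Y * amp b' g) c c' = ∑ k, slice Y c (k, c') * g k := by
  ext x y
  simp only [amp, Matrix.mul_apply, Fintype.sum_prod_type, Matrix.sum_apply, slice_apply,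
    Matrix.of_apply, mul_ite, mul_zero, Finset.sum_ite_eq', Finset.mem_univ, if_true]
  exact Finset.sum_comm

theorem slice_amp_conjTranspose_mul [Fintype b] [Fintype κ] [DecidableEq b] (g : κ → Matrix n n ℂ)
    (Y : Matrix (n × (κ × b)) (n × b') ℂ) (c : b) (c' : b') :
    slice ((amp b g)ᴴ * Y) c c' = ∑ k, (g k)ᴴ * slice Y (k, c) c' := by
  ext x y
  simp only [amp, Matrix.mul_apply, Fintype.sum_prod_type, Matrix.sum_apply, slice_apply,
    Matrix.of_apply, Matrix.conjTranspose_apply, apply_ite star, star_zero, ite_mul, zero_mul,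
    Finset.sum_ite_eq', Finset.mem_univ, if_true]
  exact Finset.sum_comm

theorem amp_mulVec_tensorVec [Fintype b] [DecidableEq b] (g : κ → Matrix n n ℂ) (M : Matrix n b ℂ) :
    amp b g *ᵥ tensorVec M = tensorVec (Matrix.of fun x (y : κ × b) => (g y.1 * M) x y.2) := by
  ext ⟨x, k, c⟩
  simp [Matrix.mulVec, dotProduct, tensorVec, amp, Matrix.mul_apply, Fintype.sum_prod_type, ite_mul]

theorem amp_conjTranspose_mul_amp [Fintype b] [Fintype κ] [DecidableEq b] (g h : κ → Matrix n n ℂ) :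
    (amp b g)ᴴ * amp b h = (∑ k, (g k)ᴴ * h k) ⊗ₖ (1 : Matrix b b ℂ) := by
  refine slice_ext fun c c' => ?_
  rw [slice_amp_conjTranspose_mul, slice_kronecker, Finset.smul_sum]
  refine Finset.sum_congr rfl fun k _ => ?_
  have h1 : slice (amp b h) (k, c) c' = (1 : Matrix b b ℂ) c c' • h k := by
    ext x y
    simp [amp, Matrix.one_apply]
  rw [h1, Matrix.mul_smul]

/-- Cauchy–Schwarz for the Hilbert–Schmidt inner product, read off from the coefficient vectors. -/
theorem norm_sq_trace_conjTranspose_mul_le [Fintype b] (A B : Matrix n b ℂ) :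
    ‖(Aᴴ * B).trace‖ ^ 2 ≤ (Aᴴ * A).trace.re * (Bᴴ * B).trace.re := by
  have h : ∀ C : Matrix n b ℂ, (Cᴴ * C).trace.re = ∑ x, ‖tensorVec C x‖ ^ 2 := by
    intro C
    rw [← star_tensorVec_dotProduct, dotProduct, Complex.re_sum]
    refine Finset.sum_congr rfl fun x _ => ?_
    rw [Pi.star_apply, Complex.star_def, ← Complex.normSq_eq_conj_mul_self, Complex.ofReal_re,
      Complex.normSq_eq_norm_sq]
  rw [h, h, ← star_tensorVec_dotProduct]
  refine le_trans ?_ (Finset.sum_mul_sq_le_sq_mul_sq _ _ _)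
  refine pow_le_pow_left₀ (norm_nonneg _) ((norm_sum_le _ _).trans_eq ?_) 2
  exact Finset.sum_congr rfl fun x _ => by rw [norm_mul, Pi.star_apply, norm_star]

end slices

theorem exists_smul_one_sub_posSemidef {m : Type*} [Fintype m] [DecidableEq m] {X : Matrix m m ℂ}
    (hX : X.IsHermitian) : ∃ c : ℝ, 0 ≤ c ∧ ((c : ℂ) • (1 : Matrix m m ℂ) - X).PosSemidef := by
  refine ⟨∑ i, |hX.eigenvalues i|, Finset.sum_nonneg fun _ _ => abs_nonneg _, ?_⟩
  set c := ∑ i, |hX.eigenvalues i|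
  let φ := Unitary.conjStarAlgAut ℂ (Matrix m m ℂ) hX.eigenvectorUnitary
  have h : (c : ℂ) • (1 : Matrix m m ℂ) - X =
      φ (Matrix.diagonal fun i => ((c - hX.eigenvalues i : ℝ) : ℂ)) := by
    have h1 : (Matrix.diagonal fun i => ((c - hX.eigenvalues i : ℝ) : ℂ)) =
        (c : ℂ) • (1 : Matrix m m ℂ) - Matrix.diagonal (RCLike.ofReal ∘ hX.eigenvalues) := by
      ext i j
      by_cases hij : i = j <;> simp [hij]
    rw [h1, map_sub, map_smul, map_one, ← hX.spectral_theorem]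
  rw [h, Unitary.conjStarAlgAut_apply]
  refine Matrix.PosSemidef.mul_mul_conjTranspose_same (Matrix.PosSemidef.diagonal fun i => ?_) _
  have : hX.eigenvalues i ≤ c := (le_abs_self _).trans
    (Finset.single_le_sum (f := fun i => |hX.eigenvalues i|) (fun _ _ => abs_nonneg _)
      (Finset.mem_univ i))
  simpa using this

/-! ### Feasible points for the theta function -/

/-- `M` has a dominating `Y ∈ S ⊗ L(B)` with `Tr_A Y ≤ l I`. -/
def IsFeasible {n b : Type*} [Fintype n] [DecidableEq b] (S : Submodule ℂ (Matrix n n ℂ))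
    (M : Matrix n b ℂ) (l : ℝ) : Prop :=
  ∃ Y : Matrix (n × b) (n × b) ℂ, (∀ c c', slice Y c c' ∈ S) ∧
    ((l : ℂ) • (1 : Matrix b b ℂ) - traceLeft Y).PosSemidef ∧
    (Y - Matrix.vecMulVec (tensorVec M) (star (tensorVec M))).PosSemidef

/-- Feasibility of `M` depends only on `M * Mᴴ`. -/
theorem IsFeasible.congr {n b b' : Type*} [Fintype n] [Fintype b] [Fintype b']
    [DecidableEq b] [DecidableEq b'] {S : Submodule ℂ (Matrix n n ℂ)} {M : Matrix n b ℂ}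
    {N : Matrix n b' ℂ} {l : ℝ} (hl : 0 ≤ l) (h : IsFeasible S M l) (hN : N * Nᴴ = M * Mᴴ) :
    IsFeasible S N l := by
  classical
  obtain ⟨Y, hY, hl', hYM⟩ := h
  obtain ⟨C, rfl, hC⟩ := exists_contraction hN
  have hK : ((1 : Matrix n n ℂ) ⊗ₖ Cᵀ)ᴴ = (1 : Matrix n n ℂ) ⊗ₖ Cᵀᴴ := by
    rw [Matrix.conjTranspose_kronecker, Matrix.conjTranspose_one]
  -- The operator I ⊗ Cᵀ carries the vector of M to the vector of M C and acts only on the auxiliary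
  -- factor, so slices stay in S.
  refine ⟨((1 : Matrix n n ℂ) ⊗ₖ Cᵀ) * Y * ((1 : Matrix n n ℂ) ⊗ₖ Cᵀ)ᴴ, ?_, ?_, ?_⟩
  · rw [hK]
    exact slice_conj_one_kronecker_mem _ _ hY
  · rw [hK, traceLeft_conj_one_kronecker]
    have h1 := hl'.mul_mul_conjTranspose_same Cᵀ
    have h2 := hC.transpose.smul (show (0 : ℂ) ≤ l by exact_mod_cast hl)
    -- l - Cᵀ (Tr_A Y) Cᵀᴴ splits as Cᵀ (l - Tr_A Y) Cᵀᴴ + l (1 - Cᴴ C)ᵀ; the second term is where 0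
    -- ≤ l and the contraction property enter.
    convert h1.add h2 using 1
    rw [Matrix.transpose_sub, Matrix.transpose_mul, Matrix.transpose_one,
      Matrix.conjTranspose_transpose, Matrix.transpose_conjTranspose]
    simp only [Matrix.mul_sub, Matrix.sub_mul, Matrix.mul_smul, Matrix.smul_mul, Matrix.mul_one,
      smul_sub]
    abel
  · have h1 := hYM.mul_mul_conjTranspose_same ((1 : Matrix n n ℂ) ⊗ₖ Cᵀ)
    rwa [Matrix.mul_sub, Matrix.sub_mul, mul_vecMulVec_mul_conjTranspose,
      one_kronecker_mulVec_tensorVec, Matrix.transpose_transpose] at h1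

theorem trace_re_le_of_traceLeft_le {n b : Type*} [Fintype n] [Fintype b] [DecidableEq b]
    {Y : Matrix (n × b) (n × b) ℂ} {l : ℝ}
    (h : ((l : ℂ) • (1 : Matrix b b ℂ) - traceLeft Y).PosSemidef) :
    Y.trace.re ≤ l * Fintype.card b := by
  have h1 := (Complex.le_def.1 h.trace_nonneg).1
  rw [Matrix.trace_sub, Matrix.trace_smul, Matrix.trace_one, trace_traceLeft] at h1
  simpa using h1

theorem slice_one_mem {n b : Type*} [DecidableEq n] [DecidableEq b] {S : Submodule ℂ (Matrix n n ℂ)} (h1 : 1 ∈ S)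
    (c c' : b) :
    slice (1 : Matrix (n × b) (n × b) ℂ) c c' ∈ S := by
  rw [← Matrix.one_kronecker_one, slice_kronecker]
  exact S.smul_mem _ h1

section theta

variable {n : Type*} [Fintype n] [DecidableEq n]

/-- Expanding the second factor in matrix units makes membership a condition on blocks. In this form
it makes sense for every second factor, which is how `IsFeasible` uses it. -/
theorem mem_tensorFull_iff (S : Submodule ℂ (Matrix n n ℂ)) (Y : Matrix (n × n) (n × n) ℂ) :
    Y ∈ tensorFull S ↔ ∀ c c', slice Y c c' ∈ S := by
  constructor
  · intro h
    induction h using Submodule.span_induction with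
    | mem Y h =>
      obtain ⟨M, hM, N, rfl⟩ := h
      intro c c'
      rw [slice_kronecker]
      exact S.smul_mem _ hM
    | zero => intro c c'; exact S.zero_mem
    | add Y Z _ _ hY hZ => intro c c'; exact S.add_mem (hY c c') (hZ c c')
    | smul r Y _ hY => intro c c'; exact S.smul_mem r (hY c c')
  · intro h
    have hY : Y = ∑ c, ∑ c', slice Y c c' ⊗ₖ Matrix.single c c' (1 : ℂ) := by
      ext ⟨x, c⟩ ⟨y, c'⟩
      simp [Matrix.sum_apply, Matrix.single_apply, ite_and]
    rw [hY]
    exact Submodule.sum_mem _ fun c _ => Submodule.sum_mem _ fun c' _ =>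
      Submodule.subset_span ⟨_, h c c', _, rfl⟩

theorem sqrtVec_eq (W : Matrix n n ℂ) : sqrtVec W = tensorVec (CFC.sqrt W) := by
  ext ⟨i, j⟩
  simp [sqrtVec, tensorVec, Matrix.mulVec, dotProduct, Fintype.sum_prod_type, Matrix.one_apply]

theorem theta_eq (S : Submodule ℂ (Matrix n n ℂ)) (W : Matrix n n ℂ) :
    theta S W = sInf {l | IsFeasible S (CFC.sqrt W) l} := by
  unfold theta IsFeasible
  congr 1
  ext l
  refine exists_congr fun Y => ?_
  rw [mem_tensorFull_iff, sqrtVec_eq]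
  rfl

theorem sqrt_mul_conjTranspose_sqrt {W : Matrix n n ℂ} (hW : 0 ≤ W) :
    CFC.sqrt W * (CFC.sqrt W)ᴴ = W := by
  have h : (CFC.sqrt W)ᴴ = CFC.sqrt W :=
    (Matrix.nonneg_iff_posSemidef.1 (CFC.sqrt_nonneg W)).isHermitian
  rw [h, CFC.sqrt_mul_sqrt_self W hW]

/-- Any factorisation W = M Mᴴ may replace √W, so a bound on ϑ can be certified over whichever
auxiliary space is convenient. -/
theorem theta_le {b : Type*} [Fintype b] [DecidableEq b] {S : Submodule ℂ (Matrix n n ℂ)}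
    {W : Matrix n n ℂ} (hW : 0 ≤ W) {M : Matrix n b ℂ} (hM : M * Mᴴ = W) {l : ℝ} (hl : 0 ≤ l)
    (h : IsFeasible S M l) : theta S W ≤ l := by
  rw [theta_eq]
  have h' := h.congr hl ((sqrt_mul_conjTranspose_sqrt hW).trans hM.symm)
  -- On the zero space every real l is feasible and `sInf` takes its default value 0, so this case
  -- is separate. Otherwise 0 ≤ Tr Y ≤ l dim A bounds the feasible values below by 0.
  rcases isEmpty_or_nonempty n with hn | hn
  · have : {l | IsFeasible S (CFC.sqrt W) l} = Set.univ := by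
      refine Set.eq_univ_of_forall fun l => ⟨0, fun c => isEmptyElim c, ?_, ?_⟩
      · rw [Subsingleton.elim ((l : ℂ) • (1 : Matrix n n ℂ) - _) 0]; exact Matrix.PosSemidef.zero
      · rw [Subsingleton.elim (0 - Matrix.vecMulVec _ _) 0]; exact Matrix.PosSemidef.zero
    rw [this, Real.sInf_univ]
    exact hl
  · refine csInf_le ⟨0, ?_⟩ h'
    rintro l ⟨Y, -, hl, hY⟩
    have h0 : Y.PosSemidef := by
      simpa using hY.add (Matrix.posSemidef_vecMulVec_self_star (tensorVec (CFC.sqrt W)))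
    have h1 := (Complex.le_def.1 h0.trace_nonneg).1
    have h2 := trace_re_le_of_traceLeft_le hl
    have h3 : (0 : ℝ) < Fintype.card n := by exact_mod_cast Fintype.card_pos
    simp only [Complex.zero_re] at h1
    exact nonneg_of_mul_nonneg_left (h1.trans h2) h3

/-- Since I ∈ S, a large multiple of the identity dominates X; its partial trace is again a multiple
of the identity. -/
theorem exists_isFeasible {S : Submodule ℂ (Matrix n n ℂ)} (h1 : 1 ∈ S) {m : Type*} [Fintype m]
    [DecidableEq m] {X : Matrix (n × m) (n × m) ℂ} (hX : X.IsHermitian) :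
    ∃ (l : ℝ) (Y : Matrix (n × m) (n × m) ℂ), (∀ c c', slice Y c c' ∈ S) ∧
      ((l : ℂ) • (1 : Matrix m m ℂ) - traceLeft Y).PosSemidef ∧ (Y - X).PosSemidef := by
  obtain ⟨c, -, hc⟩ := exists_smul_one_sub_posSemidef hX
  refine ⟨c * Fintype.card n, (c : ℂ) • 1, fun a a' => ?_, ?_, hc⟩
  · rw [slice_smul]
    exact S.smul_mem _ (slice_one_mem h1 a a')
  · rw [traceLeft_smul, ← Matrix.one_kronecker_one, traceLeft_kronecker, Matrix.trace_one, smul_smul]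
    push_cast
    rw [sub_self]
    exact Matrix.PosSemidef.zero

/-- Every value strictly above the infimum is feasible, because feasibility is monotone in l. This
avoids proving that the infimum is attained. -/
theorem isFeasible_of_theta_lt {S : Submodule ℂ (Matrix n n ℂ)} (h1 : 1 ∈ S) {W : Matrix n n ℂ}
    {l : ℝ} (h : theta S W < l) : IsFeasible S (CFC.sqrt W) l := by
  rw [theta_eq] at h
  obtain ⟨l', ⟨Y, hY, hl', hYW⟩, hlt⟩ := exists_lt_of_csInf_lt
    (exists_isFeasible h1 (Matrix.posSemidef_vecMulVec_self_star _).isHermitian) h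
  refine ⟨Y, hY, ?_, hYW⟩
  have h2 : (((l - l' : ℝ) : ℂ) • (1 : Matrix n n ℂ)).PosSemidef :=
    Matrix.PosSemidef.one.smul (by exact_mod_cast (sub_pos.2 hlt).le)
  convert hl'.add h2 using 1
  push_cast
  rw [sub_smul]
  abel

end theta

/-! ### Duality -/

section duality

variable {n b : Type*} [Fintype n] [DecidableEq b]

/-- The values `l` that bound the dominating points of `X + Xᴴ` in `S ⊗ L(B)`. -/
def upperValues (S : Submodule ℂ (Matrix n n ℂ)) (X : Matrix (n × b) (n × b) ℂ) : Set ℝ :=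
  {l | ∃ Y : Matrix (n × b) (n × b) ℂ, (∀ c c', slice Y c c' ∈ S) ∧
    ((l : ℂ) • (1 : Matrix b b ℂ) - traceLeft Y).PosSemidef ∧ (Y - (X + Xᴴ)).PosSemidef}

variable {S : Submodule ℂ (Matrix n n ℂ)} {X X' : Matrix (n × b) (n × b) ℂ}

theorem add_mem_upperValues {l l' : ℝ} (hl : l ∈ upperValues S X) (hl' : l' ∈ upperValues S X') :
    l + l' ∈ upperValues S (X + X') := by
  obtain ⟨Y, hY, h1, h2⟩ := hl
  obtain ⟨Y', hY', h1', h2'⟩ := hl'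
  refine ⟨Y + Y', fun c c' => S.add_mem (hY c c') (hY' c c'), ?_, ?_⟩
  · convert h1.add h1' using 1
    rw [traceLeft_add]
    push_cast
    rw [add_smul]
    abel
  · convert h2.add h2' using 1
    rw [Matrix.conjTranspose_add]
    abel

theorem mul_mem_upperValues {l a : ℝ} (ha : 0 ≤ a) (hl : l ∈ upperValues S X) :
    a * l ∈ upperValues S (a • X) := by
  obtain ⟨Y, hY, h1, h2⟩ := hl
  have ha' : (0 : ℂ) ≤ a := by exact_mod_cast ha
  have hs : a • X = (a : ℂ) • X := by ext; simp
  refine ⟨(a : ℂ) • Y, fun c c' => S.smul_mem _ (hY c c'), ?_, ?_⟩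
  · convert h1.smul ha' using 1
    rw [traceLeft_smul, smul_sub, smul_smul]
    push_cast
    rfl
  · convert h2.smul ha' using 1
    rw [hs, Matrix.conjTranspose_smul, smul_sub, smul_add]
    simp

open scoped Pointwise in
theorem upperValues_smul {a : ℝ} (ha : 0 < a) : upperValues S (a • X) = a • upperValues S X := by
  ext l
  rw [Set.mem_smul_set_iff_inv_smul_mem₀ ha.ne', smul_eq_mul]
  constructor
  · intro h
    have := mul_mem_upperValues (inv_nonneg.2 ha.le) h
    rwa [smul_smul, inv_mul_cancel₀ ha.ne', one_smul] at this
  · intro h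
    have := mul_mem_upperValues ha.le h
    rwa [← mul_assoc, mul_inv_cancel₀ ha.ne', one_mul] at this

theorem zero_mem_upperValues (hX : (-(X + Xᴴ)).PosSemidef) : 0 ∈ upperValues S X := by
  refine ⟨0, fun c c' => S.zero_mem, ?_, by rwa [zero_sub]⟩
  have : traceLeft (0 : Matrix (n × b) (n × b) ℂ) = 0 := by ext; simp [traceLeft]
  rw [this]
  simpa using Matrix.PosSemidef.zero

variable [Fintype b]

theorem upperValues_nonempty [DecidableEq n] (h1 : 1 ∈ S) : (upperValues S X).Nonempty :=
  exists_isFeasible h1 (Matrix.isHermitian_add_transpose_self X)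

/-- Traces give Tr(X + Xᴴ) ≤ Tr Y ≤ l dim B, which bounds l because B is nonzero. -/
theorem upperValues_bddBelow [Nonempty b] : BddBelow (upperValues S X) := by
  have h3 : (0 : ℝ) < Fintype.card b := by exact_mod_cast Fintype.card_pos
  refine ⟨(X + Xᴴ).trace.re / Fintype.card b, ?_⟩
  rintro l ⟨Y, -, hl, hY⟩
  have h1 := (Complex.le_def.1 hY.trace_nonneg).1
  have h2 := trace_re_le_of_traceLeft_le hl
  rw [Matrix.trace_sub] at h1
  simp only [Complex.zero_re, Complex.sub_re, sub_nonneg] at h1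
  rw [div_le_iff₀ h3]
  exact h1.trans h2

open scoped Pointwise in
/-- A linear functional that supports the infimum of the values `upperValues` at `X₀`. -/
theorem exists_supporting_functional [DecidableEq n] [Nonempty b] (h1 : 1 ∈ S)
    {X₀ : Matrix (n × b) (n × b) ℂ} (hX₀ : X₀ ≠ 0) :
    ∃ f : Matrix (n × b) (n × b) ℂ →ₗ[ℝ] ℝ, f X₀ = sInf (upperValues S X₀) ∧
      ∀ X, ∀ l ∈ upperValues S X, f X ≤ l := by
  -- Symmetrising X inside `upperValues` makes this a sublinear function on the whole real vector
  -- space of matrices, so Hahn–Banach applies without passing to the Hermitian subspace.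
  let p : Matrix (n × b) (n × b) ℂ → ℝ := fun X => sInf (upperValues S X)
  have hp1 : ∀ a : ℝ, 0 < a → ∀ X, p (a • X) = a * p X := fun a ha X => by
    simp only [p, upperValues_smul ha, Real.sInf_smul_of_nonneg ha.le, smul_eq_mul]
  have hp2 : ∀ X X', p (X + X') ≤ p X + p X' := fun X X' => by
    simp only [p]
    rw [← csInf_add (upperValues_nonempty h1) upperValues_bddBelow (upperValues_nonempty h1)
      upperValues_bddBelow]
    refine csInf_le_csInf upperValues_bddBelow
      ((upperValues_nonempty h1).add (upperValues_nonempty h1)) ?_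
    rintro _ ⟨l, hl, l', hl', rfl⟩
    exact add_mem_upperValues hl hl'
  have hp0 : p 0 = 0 := by
    have := hp1 2 two_pos 0
    rw [smul_zero] at this
    linarith
  have hle : ∀ x : (LinearPMap.mkSpanSingleton (σ := RingHom.id ℝ) X₀ (p X₀) hX₀).domain,
      LinearPMap.mkSpanSingleton (σ := RingHom.id ℝ) X₀ (p X₀) hX₀ x ≤ p x := by
    rintro ⟨x, hx⟩
    obtain ⟨a, rfl⟩ := Submodule.mem_span_singleton.1 hx
    refine (LinearPMap.mkSpanSingleton'_apply _ _ _ _ _).trans_le ?_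
    simp only [RingHom.id_apply, smul_eq_mul]
    rcases lt_trichotomy a 0 with ha | rfl | ha
    -- For negative a, subadditivity gives 0 = p(0) ≤ p(a X₀) + p(-a X₀), hence a p(X₀) = -p(-a X₀)
    -- ≤ p(a X₀).
    · have h2 := hp2 (a • X₀) ((-a) • X₀)
      rw [hp1 (-a) (neg_pos.2 ha), ← add_smul, add_neg_cancel, zero_smul, hp0] at h2
      linarith
    · rw [zero_mul, zero_smul, hp0]
    · rw [hp1 a ha]
  obtain ⟨f, hf1, hf2⟩ := exists_extension_of_le_sublinear _ p hp1 hp2 hle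
  refine ⟨f, ?_, fun X l hl => (hf2 X).trans (csInf_le upperValues_bddBelow hl)⟩
  have := hf1 ⟨X₀, Submodule.mem_span_singleton_self X₀⟩
  rw [this]
  exact LinearPMap.mkSpanSingleton_apply ℝ ℝ hX₀ (p X₀)

/-- A real functional that vanishes on skew-Hermitian matrices is the trace against a Hermitian
matrix. -/
theorem exists_hermitian_trace_eq {m : Type*} [Fintype m] (f : Matrix m m ℂ →ₗ[ℝ] ℝ)
    (hf : ∀ X, X + Xᴴ = 0 → f X = 0) :
    ∃ Z : Matrix m m ℂ, Z.IsHermitian ∧ ∀ X, ((Z * X).trace).re = f X := by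
  classical
  -- The entries are forced by requiring Re(Z i j · x) to equal f of the matrix with x in position
  -- (j, i), for x = 1 and for x = I.
  let Z : Matrix m m ℂ := Matrix.of fun i j =>
    (f (Matrix.single j i 1) : ℂ) - Complex.I * f (Matrix.single j i Complex.I)
  have hre : ∀ X, ((Z * X).trace).re = f X := by
    intro X
    have h1 : ∀ i j, (Z i j * X j i).re = f (Matrix.single j i (X j i)) := by
      intro i j
      have h2 : Matrix.single j i (X j i) = (X j i).re • Matrix.single j i (1 : ℂ) +
          (X j i).im • Matrix.single j i Complex.I := by
        rw [Matrix.smul_single, Matrix.smul_single, ← Matrix.single_add]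
        congr 1
        apply Complex.ext <;> simp
      rw [h2, map_add, map_smul, map_smul]
      simp [Z, mul_comm]
    simp only [Matrix.trace, Matrix.diag_apply, Matrix.mul_apply, Complex.re_sum, h1]
    conv_rhs => rw [Matrix.matrix_eq_sum_single X, map_sum]
    rw [Finset.sum_comm]
    exact Finset.sum_congr rfl fun i _ => (map_sum f _ _).symm
  refine ⟨Z, ?_, hre⟩
  have h0 : ∀ X, (((Z - Zᴴ) * X).trace).re = 0 := by
    intro X
    have h3 : ((Zᴴ * X).trace).re = ((Z * Xᴴ).trace).re := by
      rw [← Complex.conj_re, ← Complex.star_def, ← Matrix.trace_conjTranspose,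
        Matrix.conjTranspose_mul, Matrix.conjTranspose_conjTranspose, Matrix.trace_mul_comm]
    rw [Matrix.sub_mul, Matrix.trace_sub, Complex.sub_re, h3, hre, hre, ← map_sub]
    apply hf
    rw [Matrix.conjTranspose_sub, Matrix.conjTranspose_conjTranspose]
    abel
  -- Testing the skew part of Z against its own adjoint shows that its Hilbert–Schmidt norm is zero.
  have h4 := h0 (Z - Zᴴ)ᴴ
  have h5 : 0 ≤ ((Z - Zᴴ) * (Z - Zᴴ)ᴴ).trace :=
    (Matrix.posSemidef_self_mul_conjTranspose _).trace_nonneg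
  have h6 : ((Z - Zᴴ) * (Z - Zᴴ)ᴴ).trace = 0 :=
    Complex.ext h4 (Complex.le_def.1 h5).2.symm
  rw [Matrix.trace_mul_conjTranspose_self_eq_zero_iff, sub_eq_zero] at h6
  exact h6.symm

theorem trace_mul_vecMulVec_star {m : Type*} [Fintype m] (Z : Matrix m m ℂ) (v : m → ℂ) :
    (Z * Matrix.vecMulVec v (star v)).trace = star v ⬝ᵥ (Z *ᵥ v) := by
  rw [Matrix.mul_vecMulVec, Matrix.trace_vecMulVec, dotProduct_comm]

/-- Strong duality for the theta function. -/
theorem exists_dual [DecidableEq n] (hS : IsNCGraph S) {M : Matrix n b ℂ}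
    (h : 1 < sInf {l | IsFeasible S M l}) :
    ∃ (Z : Matrix (n × b) (n × b) ℂ) (ρ : Matrix b b ℂ), Z.PosSemidef ∧ ρ.PosSemidef ∧
      (∀ c c', slice (Z - (1 : Matrix n n ℂ) ⊗ₖ ρ) c c' ∈ perp S) ∧
      ρ.trace.re < (star (tensorVec M) ⬝ᵥ (Z *ᵥ tensorVec M)).re := by
  set J := Matrix.vecMulVec (tensorVec M) (star (tensorVec M)) with hJ
  have hJh : Jᴴ = J := (Matrix.posSemidef_vecMulVec_self_star _).isHermitian
  -- Since `upperValues` adds the adjoint, J is represented by J/2. The functional at J/2 exceeds 1,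
  -- so the factor 2 reappears below as ⟨M|Z|M⟩ > 2 and Tr Z ≤ 2 dim A.
  have hhalf : (2⁻¹ : ℝ) • J + ((2⁻¹ : ℝ) • J)ᴴ = J := by
    rw [Matrix.conjTranspose_smul, hJh, star_trivial, ← add_smul]
    norm_num
  have hset : {l | IsFeasible S M l} = upperValues S ((2⁻¹ : ℝ) • J) := by
    ext l
    simp only [upperValues, hhalf]
    rfl
  have hb : Nonempty b := by
    by_contra hb
    rw [not_nonempty_iff] at hb
    have : {l | IsFeasible S M l} = Set.univ := by
      refine Set.eq_univ_of_forall fun l => ⟨0, fun c => isEmptyElim c, ?_, ?_⟩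
      · rw [Subsingleton.elim ((l : ℂ) • (1 : Matrix b b ℂ) - _) 0]; exact Matrix.PosSemidef.zero
      · rw [Subsingleton.elim (0 - Matrix.vecMulVec _ _) 0]; exact Matrix.PosSemidef.zero
    -- If B were zero the infimum would be the default value 0, contradicting 1 < 0.
    rw [this, Real.sInf_univ] at h
    linarith
  rw [hset] at h
  have hX₀ : (2⁻¹ : ℝ) • J ≠ 0 := by
    intro h0
    have h1 : (0 : ℝ) ∈ upperValues S ((2⁻¹ : ℝ) • J) := by
      apply zero_mem_upperValues
      rw [h0]
      simpa using Matrix.PosSemidef.zero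
    linarith [csInf_le upperValues_bddBelow h1]
  obtain ⟨f, hf0, hf⟩ := exists_supporting_functional hS.one_mem hX₀
  rw [← hf0] at h
  obtain ⟨Z, hZh, hZ⟩ := exists_hermitian_trace_eq f (by
    have h1 : ∀ X : Matrix (n × b) (n × b) ℂ, X + Xᴴ = 0 → f X ≤ 0 := fun X hX =>
      hf X 0 (zero_mem_upperValues (by rw [hX, neg_zero]; exact Matrix.PosSemidef.zero))
    intro X hX
    refine le_antisymm (h1 X hX) ?_
    have := h1 (-X) (by rw [Matrix.conjTranspose_neg, ← neg_add, hX, neg_zero])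
    rw [map_neg] at this
    linarith)
  have hn : Nonempty n := by
    by_contra hn
    rw [not_nonempty_iff] at hn
    exact hX₀ (Subsingleton.elim _ _)
  have hcard : (0 : ℝ) < Fintype.card n := by exact_mod_cast Fintype.card_pos
  have hcard' : (Fintype.card n : ℂ) ≠ 0 := by exact_mod_cast hcard.ne'
  have hZpos : Z.PosSemidef := by
    refine Matrix.PosSemidef.of_dotProduct_mulVec_nonneg hZh fun v => ?_
    -- The zero operator dominates a negative one, so 0 is an upper value here; this yields
    -- positivity of Z.
    have h1 : f (-Matrix.vecMulVec v (star v)) ≤ 0 := by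
      refine hf _ 0 (zero_mem_upperValues ?_)
      have hv := Matrix.posSemidef_vecMulVec_self_star v
      rw [Matrix.conjTranspose_neg, hv.isHermitian.eq, ← neg_add, neg_neg]
      exact hv.add hv
    rw [map_neg, ← hZ, trace_mul_vecMulVec_star] at h1
    refine Complex.le_def.2 ⟨by simpa using h1, ?_⟩
    exact (hZh.im_star_dotProduct_mulVec_self v).symm
  -- Y + Yᴴ dominates itself and has zero partial trace, so Re Tr(Z Y) ≤ 0. Replacing Y by -Y and by
  -- iY forces Tr(Z Y) = 0.
  have hslice : ∀ Y : Matrix (n × b) (n × b) ℂ, (∀ c c', slice Y c c' ∈ S) → traceLeft Y = 0 →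
      (Z * Y).trace = 0 := by
    have h1 : ∀ Y : Matrix (n × b) (n × b) ℂ, (∀ c c', slice Y c c' ∈ S) → traceLeft Y = 0 →
        ((Z * Y).trace).re ≤ 0 := by
      intro Y hY hY0
      rw [hZ]
      refine hf _ _ ⟨Y + Yᴴ, fun c c' => S.add_mem (hY c c')
        (hS.conjTranspose_mem _ (hY c' c)), ?_, ?_⟩
      · rw [traceLeft_add, traceLeft_conjTranspose, hY0]
        simpa using Matrix.PosSemidef.zero
      · rw [sub_self]
        exact Matrix.PosSemidef.zero
    have h2 : ∀ Y : Matrix (n × b) (n × b) ℂ, (∀ c c', slice Y c c' ∈ S) → traceLeft Y = 0 →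
        ((Z * Y).trace).re = 0 := by
      intro Y hY hY0
      refine le_antisymm (h1 Y hY hY0) ?_
      have := h1 ((-1 : ℂ) • Y) (fun c c' => S.smul_mem _ (hY c c'))
        (by rw [traceLeft_smul, hY0, smul_zero])
      rw [Matrix.mul_smul, Matrix.trace_smul] at this
      simpa using this
    intro Y hY hY0
    refine Complex.ext (h2 Y hY hY0) ?_
    have := h2 (Complex.I • Y) (fun c c' => S.smul_mem _ (hY c c'))
        (by rw [traceLeft_smul, hY0, smul_zero])
    rw [Matrix.mul_smul, Matrix.trace_smul] at this
    simpa using this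
  -- This ρ is the only candidate: orthogonality of the slices of Z - I ⊗ ρ to I ∈ S says Tr_A Z =
  -- (dim A) ρ.
  refine ⟨Z, (Fintype.card n : ℂ)⁻¹ • traceLeft Z, hZpos, ?_, ?_, ?_⟩
  · exact (posSemidef_traceLeft hZpos).smul (inv_nonneg.2 (by exact_mod_cast hcard.le))
  · set ρ := (Fintype.card n : ℂ)⁻¹ • traceLeft Z with hρ
    intro c c' A hA
    let Y : Matrix (n × b) (n × b) ℂ := Aᴴ ⊗ₖ Matrix.single c' c 1
    have hZY : ((Z - (1 : Matrix n n ℂ) ⊗ₖ ρ) * Y).trace = (Aᴴ * slice (Z - 1 ⊗ₖ ρ) c c').trace := by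
      rw [trace_mul_eq_sum_slice]
      simp only [Y, slice_kronecker, Matrix.single_apply, Matrix.mul_smul, Matrix.trace_smul]
      simp [ite_and, Matrix.trace_mul_comm Aᴴ]
    rw [← hZY]
    -- Subtracting the operator I ⊗ N with the same partial trace moves the test operator into the
    -- kernel of Tr_A without leaving S ⊗ L(B).
    let Y' : Matrix (n × b) (n × b) ℂ :=
      Y - (1 : Matrix n n ℂ) ⊗ₖ ((Fintype.card n : ℂ)⁻¹ • traceLeft Y)
    have hY' : (Z * Y').trace = 0 := by
      refine hslice _ (fun d d' => ?_) ?_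
      · rw [slice_sub, slice_kronecker, slice_kronecker]
        exact S.sub_mem (S.smul_mem _ (hS.conjTranspose_mem _ hA)) (S.smul_mem _ hS.one_mem)
      · rw [traceLeft_sub, traceLeft_kronecker (1 : Matrix n n ℂ), Matrix.trace_one, smul_smul,
          mul_inv_cancel₀ hcard', one_smul, sub_self]
    rw [Matrix.mul_sub, Matrix.trace_sub, sub_eq_zero, Matrix.trace_mul_comm Z (1 ⊗ₖ _),
      trace_one_kronecker_mul] at hY'
    rw [Matrix.sub_mul, Matrix.trace_sub, hY', trace_one_kronecker_mul, hρ, Matrix.smul_mul,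
      Matrix.smul_mul, Matrix.trace_smul, Matrix.trace_smul, Matrix.trace_mul_comm, sub_self]
  · have hval : 2 < (star (tensorVec M) ⬝ᵥ (Z *ᵥ tensorVec M)).re := by
      rw [← trace_mul_vecMulVec_star, ← hJ, hZ]
      rw [map_smul, smul_eq_mul] at h
      linarith
    -- For X = I/2 the choice Y = I is admissible with value dim A.
    have htr : (Z.trace).re ≤ 2 * Fintype.card n := by
      have h1 := hf ((2⁻¹ : ℝ) • 1) (Fintype.card n) ⟨1, slice_one_mem hS.one_mem, ?_, ?_⟩
      · rw [map_smul, ← hZ, Matrix.mul_one, smul_eq_mul] at h1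
        linarith
      · rw [← Matrix.one_kronecker_one, traceLeft_kronecker, Matrix.trace_one]
        simpa using Matrix.PosSemidef.zero
      · rw [Matrix.conjTranspose_smul, Matrix.conjTranspose_one, star_trivial, ← add_smul]
        norm_num
        exact Matrix.PosSemidef.zero
    refine lt_of_le_of_lt ?_ hval
    have h2 : ((Fintype.card n : ℂ)⁻¹ • traceLeft Z).trace.re =
        (Fintype.card n : ℝ)⁻¹ * Z.trace.re := by
      rw [Matrix.trace_smul, trace_traceLeft, smul_eq_mul]
      have : ((Fintype.card n : ℂ)⁻¹) = (((Fintype.card n : ℝ)⁻¹ : ℝ) : ℂ) := by push_cast; rfl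
      rw [this, Complex.re_ofReal_mul]
    rw [h2, inv_mul_le_iff₀ hcard]
    linarith

end duality

/-! ### Matrix units of a block decomposition -/

namespace BlockDecomposition

variable {n : Type*} [Fintype n] [DecidableEq n] {S₀ : StarSubalgebra ℂ (Matrix n n ℂ)}
  (d : BlockDecomposition S₀)

/-- The index set of the matrix units of `⨁ i, L(A_i)`. -/
abbrev Idx : Type := Σ i : Fin d.r, Fin (d.p i) × Fin (d.p i)

/-- The rows of `U` that belong to the `a`-th basis vector of `A_i`. -/
def row (i : Fin d.r) (a : Fin (d.p i)) : Matrix (Fin (d.q i)) n ℂ :=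
  Matrix.of fun c x => d.U ⟨i, (a, c)⟩ x

/-- The matrix unit `|a⟩⟨b| ⊗ I` of the block `i`. -/
def unit (k : d.Idx) : Matrix n n ℂ := (d.row k.1 k.2.1)ᴴ * d.row k.1 k.2.2

theorem row_mul_conjTranspose (i : Fin d.r) (a b : Fin (d.p i)) :
    d.row i a * (d.row i b)ᴴ = if a = b then 1 else 0 := by
  ext c c'
  have h := congrFun (congrFun d.mul_conjTranspose_self ⟨i, (a, c)⟩) ⟨i, (b, c')⟩
  rw [Matrix.mul_apply] at h
  rw [Matrix.mul_apply]
  refine h.trans ?_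
  by_cases hab : a = b <;> simp [hab, Matrix.one_apply]

theorem row_mul_conjTranspose_of_ne {i j : Fin d.r} (h : i ≠ j) (a : Fin (d.p i))
    (b : Fin (d.p j)) : d.row i a * (d.row j b)ᴴ = 0 := by
  ext c c'
  have h := congrFun (congrFun d.mul_conjTranspose_self ⟨i, (a, c)⟩) ⟨j, (b, c')⟩
  rw [Matrix.mul_apply] at h
  rw [Matrix.mul_apply]
  refine h.trans ?_
  simp [*]

theorem conj_blockDiagonal (D : ∀ i, Matrix (Fin (d.p i) × Fin (d.q i))
    (Fin (d.p i) × Fin (d.q i)) ℂ) :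
    d.Uᴴ * Matrix.blockDiagonal' D * d.U = ∑ i, ∑ a, ∑ b,
      (d.row i a)ᴴ * (D i).submatrix (fun c => (a, c)) (fun c => (b, c)) * d.row i b := by
  have h : ∀ i (t : Fin (d.p i) × Fin (d.q i)) x, (d.Uᴴ * Matrix.blockDiagonal' D) x ⟨i, t⟩ =
      ∑ a, ∑ c, star (d.U ⟨i, (a, c)⟩ x) * D i (a, c) t := by
    intro i t x
    rw [Matrix.mul_apply, Fintype.sum_sigma, Finset.sum_eq_single i]
    · rw [Fintype.sum_prod_type]
      simp [Matrix.blockDiagonal'_apply_eq]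
    · intro j _ hj
      exact Finset.sum_eq_zero fun s _ => by
        rw [Matrix.blockDiagonal'_apply_ne _ _ _ hj, mul_zero]
    · simp
  ext x y
  rw [Matrix.mul_apply, Fintype.sum_sigma, Matrix.sum_apply]
  refine Finset.sum_congr rfl fun i _ => ?_
  rw [Fintype.sum_prod_type, Matrix.sum_apply]
  simp only [h, Matrix.sum_apply, Matrix.mul_apply, row, Matrix.conjTranspose_apply,
    Matrix.of_apply, Matrix.submatrix_apply, Finset.sum_mul]
  rw [Finset.sum_comm' (t' := Finset.univ) (s' := fun _ => Finset.univ) (by simp)]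
  simp_rw [Finset.sum_comm (s := (Finset.univ : Finset (Fin (d.q i))))
    (t := (Finset.univ : Finset (Fin (d.p i))))]
  rw [Finset.sum_comm]

theorem unit_conjTranspose (i : Fin d.r) (a b : Fin (d.p i)) :
    (d.unit ⟨i, a, b⟩)ᴴ = d.unit ⟨i, b, a⟩ := by
  simp [unit, Matrix.conjTranspose_mul]

theorem unit_mul_unit (i : Fin d.r) (a b a' b' : Fin (d.p i)) :
    d.unit ⟨i, a, b⟩ * d.unit ⟨i, a', b'⟩ = if b = a' then d.unit ⟨i, a, b'⟩ else 0 := by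
  have : d.unit ⟨i, a, b⟩ * d.unit ⟨i, a', b'⟩ =
      (d.row i a)ᴴ * (d.row i b * (d.row i a')ᴴ) * d.row i b' := by
    simp only [unit, Matrix.mul_assoc]
  rw [this, row_mul_conjTranspose]
  split_ifs <;> simp [unit]

theorem unit_mul_unit_of_ne {k l : d.Idx} (h : k.1 ≠ l.1) : d.unit k * d.unit l = 0 := by
  have : d.unit k * d.unit l =
      (d.row k.1 k.2.1)ᴴ * (d.row k.1 k.2.2 * (d.row l.1 l.2.1)ᴴ) * d.row l.1 l.2.2 := by
    simp only [unit, Matrix.mul_assoc]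
  rw [this, d.row_mul_conjTranspose_of_ne h]
  simp

theorem trace_unit (i : Fin d.r) (a b : Fin (d.p i)) :
    (d.unit ⟨i, a, b⟩).trace = if a = b then (d.q i : ℂ) else 0 := by
  rw [unit, Matrix.trace_mul_comm, row_mul_conjTranspose]
  simp only [eq_comm (a := b)]
  split_ifs <;> simp

theorem sum_unit_diag : ∑ i, ∑ a, d.unit ⟨i, a, a⟩ = 1 := by
  rw [← d.conjTranspose_mul_self]
  ext x y
  simp only [Matrix.sum_apply, unit, row, Matrix.mul_apply, Fintype.sum_sigma,
    Fintype.sum_prod_type, Matrix.conjTranspose_apply, Matrix.of_apply]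

theorem mem_iff_exists_unit (X : Matrix n n ℂ) :
    X ∈ S₀ ↔ ∃ c : d.Idx → ℂ, X = ∑ k, c k • d.unit k := by
  have h : ∀ M : ∀ i, Matrix (Fin (d.p i)) (Fin (d.p i)) ℂ,
      d.Uᴴ * Matrix.blockDiagonal' (fun i => M i ⊗ₖ (1 : Matrix (Fin (d.q i)) (Fin (d.q i)) ℂ)) *
        d.U = ∑ k : d.Idx, M k.1 k.2.1 k.2.2 • d.unit k := by
    intro M
    rw [conj_blockDiagonal, Fintype.sum_sigma]
    refine Finset.sum_congr rfl fun i _ => ?_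
    rw [Fintype.sum_prod_type]
    refine Finset.sum_congr rfl fun a _ => Finset.sum_congr rfl fun b _ => ?_
    have : (M i ⊗ₖ (1 : Matrix (Fin (d.q i)) (Fin (d.q i)) ℂ)).submatrix (fun c => (a, c))
        (fun c => (b, c)) = M i a b • 1 := by
      ext c c'
      simp [Matrix.kroneckerMap_apply]
    rw [this, Matrix.mul_smul, Matrix.mul_one, Matrix.smul_mul, unit]
  rw [d.mem_iff]
  constructor
  · rintro ⟨M, rfl⟩
    exact ⟨fun k => M k.1 k.2.1 k.2.2, h M⟩
  · rintro ⟨c, rfl⟩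
    exact ⟨fun i => Matrix.of fun a b => c ⟨i, a, b⟩,
      (h fun i => Matrix.of fun a b => c ⟨i, a, b⟩).symm⟩

theorem unit_mem (k : d.Idx) : d.unit k ∈ S₀ :=
  (d.mem_iff_exists_unit _).2 ⟨Pi.single k 1, by simp [Pi.single_apply, ite_smul]⟩

/-- The partial trace over A_i followed by tensoring with I is a sum over all matrix units of the
block; this Kraus form has all its operators in S₀. -/
theorem Psi_eq (W : Matrix n n ℂ) :
    d.Psi W = ∑ k : d.Idx, (d.q k.1 : ℂ)⁻¹ • (d.unit k * W * (d.unit k)ᴴ) := by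
  rw [Psi, conj_blockDiagonal, Fintype.sum_sigma]
  refine Finset.sum_congr rfl fun i _ => ?_
  rw [Fintype.sum_prod_type]
  refine Finset.sum_congr rfl fun a _ => ?_
  have ht : traceLeft (Matrix.blockDiag' (d.U * W * d.Uᴴ) i) =
      ∑ b, d.row i b * W * (d.row i b)ᴴ := by
    ext c c'
    simp only [traceLeft, Matrix.of_apply, Matrix.sum_apply, Matrix.blockDiag'_apply]
    rfl
  rw [Finset.sum_eq_single a]
  · have h1 : ((d.q i : ℂ)⁻¹ • ((1 : Matrix (Fin (d.p i)) (Fin (d.p i)) ℂ) ⊗ₖ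
        traceLeft (Matrix.blockDiag' (d.U * W * d.Uᴴ) i))).submatrix (fun c => (a, c))
          (fun c => (a, c)) = (d.q i : ℂ)⁻¹ • ∑ b, d.row i b * W * (d.row i b)ᴴ := by
      rw [← ht]
      ext c c'
      simp [Matrix.kroneckerMap_apply]
    rw [h1, Matrix.mul_smul, Matrix.smul_mul, Matrix.mul_sum, Matrix.sum_mul, Finset.smul_sum]
    refine Finset.sum_congr rfl fun b _ => ?_
    simp only [unit, Matrix.conjTranspose_mul, Matrix.conjTranspose_conjTranspose, Matrix.mul_assoc]
  · intro b _ hb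
    have h1 : ((d.q i : ℂ)⁻¹ • ((1 : Matrix (Fin (d.p i)) (Fin (d.p i)) ℂ) ⊗ₖ
        traceLeft (Matrix.blockDiag' (d.U * W * d.Uᴴ) i))).submatrix (fun c => (a, c))
          (fun c => (b, c)) = 0 := by
      ext c c'
      simp [Matrix.kroneckerMap_apply, hb.symm]
    rw [h1]
    simp
  · simp

/-- The trace pairing of the matrix units. -/
theorem trace_conjTranspose_unit_mul_unit (k l : d.Idx) :
    ((d.unit k)ᴴ * d.unit l).trace = if k = l then (d.q k.1 : ℂ) else 0 := by
  obtain ⟨i, a, b⟩ := k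
  obtain ⟨j, a', b'⟩ := l
  rw [unit_conjTranspose]
  by_cases hij : i = j
  · subst hij
    rw [unit_mul_unit]
    by_cases h : a = a' <;> simp [h, trace_unit]
  · rw [unit_mul_unit_of_ne d hij]
    simp [hij]

theorem q_ne_zero (i : Fin d.r) : (d.q i : ℂ) ≠ 0 := by exact_mod_cast (d.q_pos i).ne'

theorem p_ne_zero (i : Fin d.r) : (d.p i : ℂ) ≠ 0 := by exact_mod_cast (d.p_pos i).ne'

/-- The component of `X` in `S₀`, with the coefficients of block `i` rescaled by `w i`. -/
noncomputable def comp (w : Fin d.r → ℂ) (X : Matrix n n ℂ) : Matrix n n ℂ :=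
  ∑ k : d.Idx, (w k.1 * ((d.unit k)ᴴ * X).trace) • d.unit k

theorem comp_mem (w : Fin d.r → ℂ) (X : Matrix n n ℂ) : d.comp w X ∈ S₀ :=
  (d.mem_iff_exists_unit _).2 ⟨_, rfl⟩

/-- The Hilbert-Schmidt projection onto `S₀`. -/
noncomputable def proj (X : Matrix n n ℂ) : Matrix n n ℂ := d.comp (fun i => (d.q i : ℂ)⁻¹) X

theorem proj_mem (X : Matrix n n ℂ) : d.proj X ∈ S₀ := d.comp_mem _ X

theorem proj_eq_self {X : Matrix n n ℂ} (hX : X ∈ S₀) : d.proj X = X := by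
  obtain ⟨c, rfl⟩ := (d.mem_iff_exists_unit X).1 hX
  refine Finset.sum_congr rfl fun k _ => ?_
  congr 1
  simp only [Matrix.mul_sum, Matrix.trace_sum, Matrix.mul_smul, Matrix.trace_smul,
    trace_conjTranspose_unit_mul_unit, smul_eq_mul, mul_ite, mul_zero, Finset.sum_ite_eq,
    Finset.mem_univ, if_true]
  rw [mul_comm (c k), inv_mul_cancel_left₀ (d.q_ne_zero _)]

theorem trace_conjTranspose_mul_proj {A : Matrix n n ℂ} (hA : A ∈ S₀) (X : Matrix n n ℂ) :
    (Aᴴ * d.proj X).trace = (Aᴴ * X).trace := by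
  obtain ⟨c, rfl⟩ := (d.mem_iff_exists_unit A).1 hA
  simp only [Matrix.conjTranspose_sum, Matrix.sum_mul, Matrix.trace_sum, Matrix.conjTranspose_smul,
    Matrix.smul_mul, Matrix.trace_smul]
  refine Finset.sum_congr rfl fun k _ => ?_
  congr 1
  simp only [proj, comp, Matrix.mul_sum, Matrix.trace_sum, Matrix.mul_smul, Matrix.trace_smul,
    trace_conjTranspose_unit_mul_unit, smul_eq_mul, mul_ite, mul_zero, Finset.sum_ite_eq,
    Finset.mem_univ, if_true]
  rw [mul_comm, mul_inv_cancel_left₀ (d.q_ne_zero _)]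

theorem unit_mul_comp (w : Fin d.r → ℂ) (X : Matrix n n ℂ) (i : Fin d.r) (a b : Fin (d.p i)) :
    d.unit ⟨i, a, b⟩ * d.comp w X =
      w i • ∑ e, (d.unit ⟨i, e, b⟩ * X).trace • d.unit ⟨i, a, e⟩ := by
  rw [comp, Matrix.mul_sum, Fintype.sum_sigma, Finset.sum_eq_single i]
  · rw [Fintype.sum_prod_type, Finset.sum_eq_single b, Finset.smul_sum]
    · refine Finset.sum_congr rfl fun e _ => ?_
      rw [Matrix.mul_smul, unit_mul_unit, if_pos rfl, unit_conjTranspose, smul_smul]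
    · intro c _ hc
      refine Finset.sum_eq_zero fun e _ => ?_
      rw [Matrix.mul_smul, unit_mul_unit, if_neg hc.symm, smul_zero]
    · simp
  · intro j _ hj
    refine Finset.sum_eq_zero fun e _ => ?_
    rw [Matrix.mul_smul, unit_mul_unit_of_ne d (by exact hj.symm), smul_zero]
  · simp

/-- The matrix units rescaled in each block. -/
noncomputable def scaledUnit (w : Fin d.r → ℝ) (k : d.Idx) : Matrix n n ℂ :=
  (w k.1 : ℂ) • d.unit k

theorem scaledUnit_mem (w : Fin d.r → ℝ) (k : d.Idx) : d.scaledUnit w k ∈ S₀ :=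
  S₀.smul_mem (d.unit_mem k) _

/-- In block i each diagonal unit arises p i times, once for every row index, so weights with
product 1/p i average to the identity. With equal weights this makes `amp` an isometry; with √q/p
and 1/√q it gives a left inverse of the lift. -/
theorem sum_conjTranspose_scaledUnit_mul {w w' : Fin d.r → ℝ} (h : ∀ i, w i * w' i = (d.p i : ℝ)⁻¹) :
    ∑ k, (d.scaledUnit w k)ᴴ * d.scaledUnit w' k = 1 := by
  rw [← d.sum_unit_diag, Fintype.sum_sigma]
  refine Finset.sum_congr rfl fun i _ => ?_
  rw [Fintype.sum_prod_type_right]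
  refine Finset.sum_congr rfl fun b _ => ?_
  have h1 : ∀ a, (d.scaledUnit w ⟨i, a, b⟩)ᴴ * d.scaledUnit w' ⟨i, a, b⟩ =
      (d.p i : ℂ)⁻¹ • d.unit ⟨i, b, b⟩ := by
    intro a
    have h2 : (w i : ℂ) * w' i = (d.p i : ℂ)⁻¹ := by
      rw [← Complex.ofReal_mul, h i]
      push_cast
      rfl
    simp only [scaledUnit, Matrix.conjTranspose_smul, unit_conjTranspose, Matrix.smul_mul,
      Matrix.mul_smul, unit_mul_unit, if_true, smul_smul, Complex.star_def, Complex.conj_ofReal]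
    rw [mul_comm, h2]
  simp only [h1, Finset.sum_const, Finset.card_univ, Fintype.card_fin]
  rw [← Nat.cast_smul_eq_nsmul ℂ, smul_smul, mul_inv_cancel₀ (d.p_ne_zero i), one_smul]

/-- Only units l in the same block and row as k contribute, and cyclicity turns each trace into a
coefficient of X. This is the slicewise form of the intertwining relation T H = H R' in
`trace_amp_mul_le`. -/
theorem sum_trace_smul_scaledUnit {w : Fin d.r → ℝ} {X : Matrix n n ℂ} (k : d.Idx) :
    ∑ l, (d.scaledUnit w k * X * (d.scaledUnit w l)ᴴ).trace • d.scaledUnit w l =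
      d.scaledUnit w k * d.comp (fun i => (w i : ℂ) ^ 2) X := by
  obtain ⟨i, a, b⟩ := k
  have hr : d.scaledUnit w ⟨i, a, b⟩ * d.comp (fun i => (w i : ℂ) ^ 2) X = (w i : ℂ) •
      ((w i : ℂ) ^ 2 • ∑ e, (d.unit ⟨i, e, b⟩ * X).trace • d.unit ⟨i, a, e⟩) := by
    rw [scaledUnit, Matrix.smul_mul, unit_mul_comp]
  rw [hr, Fintype.sum_sigma, Finset.sum_eq_single i]
  · rw [Fintype.sum_prod_type, Finset.sum_eq_single a, Finset.smul_sum, Finset.smul_sum]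
    · refine Finset.sum_congr rfl fun e _ => ?_
      simp only [scaledUnit, Matrix.conjTranspose_smul, unit_conjTranspose, Matrix.smul_mul,
        Matrix.mul_smul, Matrix.trace_smul, smul_smul, Complex.star_def, Complex.conj_ofReal]
      rw [Matrix.trace_mul_cycle, unit_mul_unit, if_pos rfl]
      simp only [smul_eq_mul]
      congr 1
      ring
    · intro c _ hc
      refine Finset.sum_eq_zero fun e _ => ?_
      simp only [scaledUnit, Matrix.conjTranspose_smul, unit_conjTranspose, Matrix.smul_mul,
        Matrix.mul_smul, Matrix.trace_smul]
      rw [Matrix.trace_mul_cycle, unit_mul_unit, if_neg hc]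
      simp
    · simp
  · intro j _ hj
    refine Finset.sum_eq_zero fun ⟨c, e⟩ _ => ?_
    simp only [scaledUnit, Matrix.conjTranspose_smul, unit_conjTranspose, Matrix.smul_mul,
        Matrix.mul_smul, Matrix.trace_smul]
    rw [Matrix.trace_mul_cycle, unit_mul_unit_of_ne d (by exact hj)]
    simp
  · simp

theorem unit_mul_comp_eq_smul (w : Fin d.r → ℂ) (X : Matrix n n ℂ) (k : d.Idx) :
    d.unit k * d.comp w X = w k.1 • (d.unit k * d.comp 1 X) := by
  obtain ⟨i, a, b⟩ := k
  rw [unit_mul_comp, unit_mul_comp, Pi.one_apply, one_smul]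

theorem unit_mul_comp_mul_of_ne {k l : d.Idx} (h : k.1 ≠ l.1) (w : Fin d.r → ℂ) (X : Matrix n n ℂ) :
    d.unit k * d.comp w X * (d.unit l)ᴴ = 0 := by
  obtain ⟨i, a, b⟩ := k
  obtain ⟨j, a', b'⟩ := l
  rw [unit_mul_comp, unit_conjTranspose, Matrix.smul_mul, Matrix.sum_mul]
  rw [Finset.sum_eq_zero, smul_zero]
  intro e _
  rw [Matrix.smul_mul, unit_mul_unit_of_ne d (by exact h), smul_zero]

/-- Units from different blocks give zero, and inside one block only the product of the squared unit
weight with the component weight is visible. -/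
theorem scaledUnit_mul_comp_mul {w w' : Fin d.r → ℝ} {v v' : Fin d.r → ℂ}
    (h : ∀ i, (w i : ℂ) ^ 2 * v i = (w' i : ℂ) ^ 2 * v' i) (X : Matrix n n ℂ) (k l : d.Idx) :
    d.scaledUnit w k * d.comp v X * (d.scaledUnit w l)ᴴ =
      d.scaledUnit w' k * d.comp v' X * (d.scaledUnit w' l)ᴴ := by
  simp only [scaledUnit, Matrix.conjTranspose_smul, Matrix.smul_mul, Matrix.mul_smul, smul_smul,
    Complex.star_def, Complex.conj_ofReal]
  by_cases hkl : k.1 = l.1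
  · rw [unit_mul_comp_eq_smul d v, unit_mul_comp_eq_smul d v', Matrix.smul_mul, Matrix.smul_mul,
      smul_smul, smul_smul, ← hkl]
    congr 1
    linear_combination h k.1
  · rw [unit_mul_comp_mul_of_ne d hkl, unit_mul_comp_mul_of_ne d hkl, smul_zero, smul_zero]

end BlockDecomposition

/-! ### Complements of `S₀`-graphs -/

section complement

variable {n : Type*} [Fintype n] [DecidableEq n] {S₀ : StarSubalgebra ℂ (Matrix n n ℂ)}
  {S : Submodule ℂ (Matrix n n ℂ)}

theorem IsS0Graph.mem_of_mem (hS : IsS0Graph S₀ S) {A : Matrix n n ℂ} (hA : A ∈ S₀) : A ∈ S :=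
  hS.le hA

theorem IsS0Graph.mul_mul_mem (hS : IsS0Graph S₀ S) {A X B : Matrix n n ℂ} (hA : A ∈ S₀)
    (hX : X ∈ S) (hB : B ∈ S₀) : A * X * B ∈ S := by
  have := hS.bimodule
  rw [← this]
  exact Submodule.mul_mem_mul (Submodule.mul_mem_mul hA hX) hB

theorem IsS0Graph.conjTranspose_mem (hS : IsS0Graph S₀ S) {A : Matrix n n ℂ} (hA : A ∈ S) :
    Aᴴ ∈ S :=
  hS.isNCGraph.conjTranspose_mem A hA

theorem conjTranspose_mem_perp (hS : ∀ X ∈ S, Xᴴ ∈ S) {X : Matrix n n ℂ} (hX : X ∈ perp S) :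
    Xᴴ ∈ perp S := by
  intro Y hY
  have := hX _ (hS Y hY)
  rw [Matrix.conjTranspose_conjTranspose, Matrix.trace_mul_comm] at this
  rw [← Matrix.conjTranspose_mul, Matrix.trace_conjTranspose, this, star_zero]

theorem IsS0Graph.mul_mul_mem_perp (hS : IsS0Graph S₀ S) {A X B : Matrix n n ℂ} (hA : A ∈ S₀)
    (hX : X ∈ perp S) (hB : B ∈ S₀) : A * X * B ∈ perp S := by
  intro Y hY
  have h := hX _ (hS.mul_mul_mem (star_mem hA) hY (star_mem hB))
  rw [Matrix.star_eq_conjTranspose, Matrix.star_eq_conjTranspose, Matrix.conjTranspose_mul,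
    Matrix.conjTranspose_mul, Matrix.conjTranspose_conjTranspose,
    Matrix.conjTranspose_conjTranspose] at h
  rw [← h, ← Matrix.mul_assoc, Matrix.trace_mul_comm]
  simp only [Matrix.mul_assoc]

theorem IsS0Graph.compl (hS : IsS0Graph S₀ S) : IsS0Graph S₀ (compl S₀ S) where
  isNCGraph :=
    { conjTranspose_mem := by
        intro X hX
        obtain ⟨Y, hY, A, hA, rfl⟩ := Submodule.mem_sup.1 hX
        rw [Matrix.conjTranspose_add]
        exact Submodule.add_mem_sup (conjTranspose_mem_perp hS.isNCGraph.conjTranspose_mem hY)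
          (star_mem (S := StarSubalgebra ℂ (Matrix n n ℂ)) (s := S₀) hA)
      one_mem := le_sup_right (α := Submodule ℂ (Matrix n n ℂ)) S₀.one_mem }
  le := le_sup_right
  bimodule := by
    refine le_antisymm ?_ fun X hX => ?_
    · have h : ∀ A ∈ S₀, ∀ X ∈ NCGraph.compl S₀ S, ∀ B ∈ S₀, A * X * B ∈ NCGraph.compl S₀ S := by
        intro A hA X hX B hB
        obtain ⟨Y, hY, C, hC, rfl⟩ := Submodule.mem_sup.1 hX
        rw [Matrix.mul_add, Matrix.add_mul]
        exact Submodule.add_mem_sup (hS.mul_mul_mem_perp hA hY hB)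
          (S₀.mul_mem (S₀.mul_mem hA hC) hB)
      rw [Submodule.mul_le]
      intro Z hZ B hB
      induction hZ using Submodule.mul_induction_on' with
      | mem_mul_mem A hA X hX => exact h A hA X hX B hB
      | add Z _ Z' _ h1 h2 =>
        rw [Matrix.add_mul]
        exact Submodule.add_mem _ h1 h2
    · have := Submodule.mul_mem_mul (Submodule.mul_mem_mul
        (show (1 : Matrix n n ℂ) ∈ Subalgebra.toSubmodule S₀.toSubalgebra from S₀.one_mem) hX)
        (show (1 : Matrix n n ℂ) ∈ Subalgebra.toSubmodule S₀.toSubalgebra from S₀.one_mem)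
      rwa [one_mul, mul_one] at this

/-- For a subspace closed under adjoints the Hilbert–Schmidt complement is the complement for the
bilinear form Tr(X Y), which is nondegenerate and reflexive. -/
theorem perp_perp (hS : ∀ X ∈ S, Xᴴ ∈ S) : perp (perp S) = S := by
  let B : LinearMap.BilinForm ℂ (Matrix n n ℂ) :=
    (LinearMap.mul ℂ (Matrix n n ℂ)).compr₂ (Matrix.traceLinearMap n ℂ ℂ)
  have hB : ∀ x y, B x y = (x * y).trace := fun x y => rfl
  have hrefl : B.IsRefl := by
    intro x y h
    rw [hB] at h ⊢
    rw [Matrix.trace_mul_comm, h]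
  have hnd : B.Nondegenerate := by
    refine (LinearMap.IsRefl.nondegenerate_iff_separatingLeft hrefl).2 fun x hx => ?_
    have := hx xᴴ
    rwa [hB, Matrix.trace_mul_conjTranspose_self_eq_zero_iff] at this
  have hperp : ∀ T : Submodule ℂ (Matrix n n ℂ), (∀ X ∈ T, Xᴴ ∈ T) → perp T = B.orthogonal T := by
    intro T hT
    ext X
    refine ⟨fun h Y hY => ?_, fun h Y hY => h _ (hT Y hY)⟩
    have := h _ (hT Y hY)
    rwa [Matrix.conjTranspose_conjTranspose] at this
  rw [hperp _ fun X hX => conjTranspose_mem_perp hS hX, hperp _ hS,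
    LinearMap.BilinForm.orthogonal_orthogonal hnd hrefl]

theorem mem_of_mem_perp_compl (hS : IsS0Graph S₀ S) {X : Matrix n n ℂ}
    (hX : X ∈ perp (compl S₀ S)) : X ∈ S := by
  rw [← perp_perp hS.isNCGraph.conjTranspose_mem]
  exact fun Y hY => hX Y (le_sup_left (α := Submodule ℂ (Matrix n n ℂ)) hY)

theorem trace_eq_zero_of_mem_perp_compl {X A : Matrix n n ℂ}
    (hX : X ∈ perp (compl S₀ S)) (hA : A ∈ S₀) : (A * X).trace = 0 := by
  have := hX _ (le_sup_right (α := Submodule ℂ (Matrix n n ℂ))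
    (star_mem (S := StarSubalgebra ℂ (Matrix n n ℂ)) (s := S₀) hA))
  rwa [Matrix.star_eq_conjTranspose, Matrix.conjTranspose_conjTranspose] at this

/-- As S₀ ⊆ S, the projection onto S₀ kills the S^⊥ summand of X, so removing it leaves exactly that
summand. -/
theorem sub_proj_mem_perp (d : BlockDecomposition S₀) (hS : IsS0Graph S₀ S) {X : Matrix n n ℂ}
    (hX : X ∈ compl S₀ S) : X - d.proj X ∈ perp S := by
  obtain ⟨Y, hY, A, hA, rfl⟩ := Submodule.mem_sup.1 hX
  have h : d.proj (Y + A) = A := by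
    conv_rhs => rw [← d.proj_eq_self hA]
    refine Finset.sum_congr rfl fun k _ => ?_
    rw [Matrix.mul_add, Matrix.trace_add, hY _ (hS.mem_of_mem (d.unit_mem k)), zero_add]
  rwa [h, add_sub_cancel_right]

/-- For X ∈ S, the part X - `proj` X is still in S and is orthogonal to S₀, hence orthogonal to both
S^⊥ and S₀; the rest lies in S₀. -/
theorem compl_compl (d : BlockDecomposition S₀) (hS : IsS0Graph S₀ S) :
    compl S₀ (compl S₀ S) = S := by
  refine le_antisymm (sup_le (fun X hX => mem_of_mem_perp_compl hS hX) hS.le) fun X hX => ?_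
  have h : X - d.proj X ∈ perp (compl S₀ S) := by
    intro Y hY
    obtain ⟨Z, hZ, A, hA, rfl⟩ := Submodule.mem_sup.1 hY
    have h1 : (Zᴴ * (X - d.proj X)).trace = 0 := by
      have h2 := hZ _ (S.sub_mem hX (hS.mem_of_mem (d.proj_mem X)))
      rw [← star_eq_zero, ← Matrix.trace_conjTranspose, Matrix.conjTranspose_mul,
        Matrix.conjTranspose_conjTranspose]
      exact h2
    rw [Matrix.conjTranspose_add, Matrix.add_mul, Matrix.trace_add, h1, Matrix.mul_sub,
      Matrix.trace_sub, d.trace_conjTranspose_mul_proj hA, sub_self, add_zero]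
  rw [← sub_add_cancel X (d.proj X)]
  exact Submodule.add_mem_sup h (d.proj_mem X)

end complement

/-! ### The two inequalities between weighted theta functions -/

section inequalities

variable {n b : Type*} [Fintype n] [DecidableEq n] [Fintype b]
  {S₀ : StarSubalgebra ℂ (Matrix n n ℂ)} {S : Submodule ℂ (Matrix n n ℂ)}

/-- Blocks `f k * M` whose Gram matrix is `Psi (M * Mᴴ)`. -/
noncomputable def BlockDecomposition.lift (d : BlockDecomposition S₀) (M : Matrix n b ℂ) :
    Matrix n (d.Idx × b) ℂ :=
  Matrix.of fun x y => (d.scaledUnit (fun i => (√(d.q i))⁻¹) y.1 * M) x y.2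

theorem BlockDecomposition.lift_mul_conjTranspose (d : BlockDecomposition S₀) (M : Matrix n b ℂ) :
    d.lift M * (d.lift M)ᴴ = d.Psi (M * Mᴴ) := by
  rw [d.Psi_eq]
  have h : ∀ k : d.Idx, (d.q k.1 : ℂ)⁻¹ • (d.unit k * (M * Mᴴ) * (d.unit k)ᴴ) =
      (d.scaledUnit (fun i => (√(d.q i))⁻¹) k * M) *
        (d.scaledUnit (fun i => (√(d.q i))⁻¹) k * M)ᴴ := by
    intro k
    have h1 : (d.q k.1 : ℂ)⁻¹ = (((√(d.q k.1))⁻¹ : ℝ) : ℂ) * (((√(d.q k.1))⁻¹ : ℝ) : ℂ) := by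
      rw [← Complex.ofReal_mul, ← mul_inv, Real.mul_self_sqrt (Nat.cast_nonneg _)]
      push_cast
      rfl
    simp only [scaledUnit, Matrix.conjTranspose_mul, Matrix.conjTranspose_smul, Matrix.smul_mul,
      Matrix.mul_smul, smul_smul, Complex.star_def, Complex.conj_ofReal, Matrix.mul_assoc, h1]
  simp only [h]
  ext x y
  rw [Matrix.mul_apply, Fintype.sum_prod_type, Matrix.sum_apply]
  refine Finset.sum_congr rfl fun k _ => ?_
  rw [Matrix.mul_apply]
  rfl

theorem BlockDecomposition.Psi_nonneg (d : BlockDecomposition S₀) {W : Matrix n n ℂ} (hW : 0 ≤ W) :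
    0 ≤ d.Psi W := by
  rw [← sqrt_mul_conjTranspose_sqrt hW, ← d.lift_mul_conjTranspose, Matrix.nonneg_iff_posSemidef]
  exact Matrix.posSemidef_self_mul_conjTranspose _

/-- An operator `1 + T` with `T` orthogonal to the complement bounds the theta function of `Psi`. -/
theorem isFeasible_lift [DecidableEq b] (d : BlockDecomposition S₀) (hS : IsS0Graph S₀ S) {M : Matrix n b ℂ}
    {Z : Matrix (n × b) (n × b) ℂ} (hZ : ∀ c c', slice (Z - 1) c c' ∈ perp (compl S₀ S))
    (hM : (Z - Matrix.vecMulVec (tensorVec M) (star (tensorVec M))).PosSemidef) :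
    IsFeasible S (d.lift M) 1 := by
  set f := d.scaledUnit (fun i => (√(d.q i))⁻¹) with hf
  have hfm : ∀ k, f k ∈ S₀ := fun k => d.scaledUnit_mem _ k
  have hfm' : ∀ k, (f k)ᴴ ∈ S₀ := fun k => star_mem (hfm k)
  have hsl : ∀ c c', slice Z c c' = slice (Z - 1) c c' + slice 1 c c' := fun c c' => by
    rw [slice_sub, sub_add_cancel]
  refine ⟨amp b f * Z * (amp b f)ᴴ, ?_, ?_, ?_⟩
  · rintro ⟨k, c⟩ ⟨l, c'⟩
    rw [slice_mul_amp_conjTranspose, slice_amp_mul]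
    refine hS.mul_mul_mem (hfm k) ?_ (hfm' l)
    rw [hsl]
    exact S.add_mem (mem_of_mem_perp_compl hS (hZ c c')) (slice_one_mem hS.isNCGraph.one_mem c c')
  -- The product (f l)ᴴ (f k) lies in S₀, to which the slices of Z - 1 are orthogonal; only the
  -- identity part remains, and the f k are Hilbert–Schmidt orthonormal.
  · have : traceLeft (amp b f * Z * (amp b f)ᴴ) = 1 := by
      ext ⟨k, c⟩ ⟨l, c'⟩
      have h1 : ((f l)ᴴ * f k).trace = if k = l then 1 else 0 := by
        simp only [hf, BlockDecomposition.scaledUnit, Matrix.conjTranspose_smul, Matrix.smul_mul,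
          Matrix.mul_smul, Matrix.trace_smul, d.trace_conjTranspose_unit_mul_unit]
        by_cases hkl : k = l
        · subst hkl
          simp only [if_true, smul_eq_mul, Complex.star_def, Complex.conj_ofReal]
          have h2 : (√(d.q k.1))⁻¹ * ((√(d.q k.1))⁻¹ * (d.q k.1 : ℝ)) = 1 := by
            rw [← mul_assoc, ← mul_inv, Real.mul_self_sqrt (Nat.cast_nonneg _)]
            exact inv_mul_cancel₀ (by exact_mod_cast (d.q_pos k.1).ne')
          exact_mod_cast h2
        · simp [hkl, Ne.symm hkl]
      rw [traceLeft_apply, slice_mul_amp_conjTranspose, slice_amp_mul, Matrix.trace_mul_cycle, hsl,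
        Matrix.mul_add, Matrix.trace_add,
        trace_eq_zero_of_mem_perp_compl (hZ c c') (S₀.mul_mem (hfm' l) (hfm k)), zero_add,
        ← Matrix.one_kronecker_one, slice_kronecker, Matrix.mul_smul, Matrix.mul_one,
        Matrix.trace_smul, h1]
      by_cases hc : c = c' <;> by_cases hk : k = l <;> simp [hc, hk, Matrix.one_apply]
    rw [this]
    simpa using Matrix.PosSemidef.zero
  · have h := hM.mul_mul_conjTranspose_same (amp b f)
    rwa [Matrix.mul_sub, Matrix.sub_mul, mul_vecMulVec_mul_conjTranspose, amp_mulVec_tensorVec] at h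

/-- The dual certificate for ϑ(S^c, W') > 1 is converted into a primal feasible point for S, and W
is read off from its rank-one part. -/
theorem exists_one_lt_trace (d : BlockDecomposition S₀) (hS : IsS0Graph S₀ S)
    {W' : Matrix n n ℂ} (hW' : 0 ≤ W') (h : 1 < theta (compl S₀ S) W') :
    ∃ W : Matrix n n ℂ, 0 ≤ W ∧ theta S (d.Psi W) ≤ 1 ∧ 1 < (W * W').trace.re := by
  rw [theta_eq] at h
  obtain ⟨Z, ρ, hZ, hρ, hperp, hlt⟩ := exists_dual hS.compl.isNCGraph h
  set V := CFC.sqrt W' with hV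
  have hVV : V * Vᴴ = W' := sqrt_mul_conjTranspose_sqrt hW'
  -- Adding ε I to both Z and ρ leaves Z - I ⊗ ρ unchanged and makes ρ invertible. It raises Tr ρ by
  -- ε dim A, so dividing the gap by dim A + 1 keeps the inequality strict.
  obtain ⟨ε, hε, hεlt⟩ : ∃ ε : ℝ, 0 < ε ∧
      ρ.trace.re + ε * Fintype.card n < (star (tensorVec V) ⬝ᵥ (Z *ᵥ tensorVec V)).re := by
    have hc : (0 : ℝ) < Fintype.card n + 1 := by positivity
    refine ⟨((star (tensorVec V) ⬝ᵥ (Z *ᵥ tensorVec V)).re - ρ.trace.re) / (Fintype.card n + 1),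
      div_pos (sub_pos.2 hlt) hc, ?_⟩
    rw [← lt_sub_iff_add_lt', div_mul_eq_mul_div, div_lt_iff₀ hc]
    nlinarith
  have hε' : (0 : ℂ) < ε := by exact_mod_cast hε
  -- make the weight invertible
  set Z₁ := Z + (ε : ℂ) • (1 : Matrix (n × n) (n × n) ℂ) with hZ₁
  set ρ₁ := ρ + (ε : ℂ) • (1 : Matrix n n ℂ) with hρ₁
  have hZ₁p : Z₁.PosSemidef := hZ.add (Matrix.PosSemidef.one.smul hε'.le)
  have hρ₁p : ρ₁.PosDef := Matrix.PosDef.posSemidef_add hρ (Matrix.PosDef.one.smul hε')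
  have hdiff : Z₁ - (1 : Matrix n n ℂ) ⊗ₖ ρ₁ = Z - (1 : Matrix n n ℂ) ⊗ₖ ρ := by
    rw [hZ₁, hρ₁, Matrix.kronecker_add, Matrix.kronecker_smul, Matrix.one_kronecker_one]
    abel
  have hval : (star (tensorVec V) ⬝ᵥ (Z *ᵥ tensorVec V)).re ≤
      (star (tensorVec V) ⬝ᵥ (Z₁ *ᵥ tensorVec V)).re := by
    have h1 := (Matrix.PosSemidef.one.smul hε'.le : ((ε : ℂ) •
      (1 : Matrix (n × n) (n × n) ℂ)).PosSemidef).dotProduct_mulVec_nonneg (tensorVec V)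
    rw [hZ₁, Matrix.add_mulVec, dotProduct_add, Complex.add_re]
    have h2 := (Complex.le_def.1 h1).1
    simp only [Complex.zero_re] at h2
    linarith
  obtain ⟨σ, τ, hσ, hσσ, hστ, hτ⟩ : ∃ σ τ : Matrix n n ℂ, σᴴ = σ ∧ σ * σ = ρ₁ ∧ σ * τ = 1 ∧
      τᴴ = τ := by
    have hσ : (CFC.sqrt ρ₁)ᴴ = CFC.sqrt ρ₁ :=
      (Matrix.nonneg_iff_posSemidef.1 (CFC.sqrt_nonneg ρ₁)).isHermitian
    have hσσ : CFC.sqrt ρ₁ * CFC.sqrt ρ₁ = ρ₁ := CFC.sqrt_mul_sqrt_self ρ₁ hρ₁p.posSemidef.nonneg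
    have hu : IsUnit (CFC.sqrt ρ₁) := by
      have := hρ₁p.isUnit
      rw [← hσσ, Matrix.isUnit_iff_isUnit_det, Matrix.det_mul] at this
      rw [Matrix.isUnit_iff_isUnit_det]
      exact isUnit_of_mul_isUnit_left this
    refine ⟨CFC.sqrt ρ₁, (CFC.sqrt ρ₁)⁻¹, hσ, hσσ,
      Matrix.mul_nonsing_inv _ ((Matrix.isUnit_iff_isUnit_det _).1 hu), ?_⟩
    rw [Matrix.conjTranspose_nonsing_inv, hσ]
  have hτσ : τ * σ = 1 := mul_eq_one_comm.1 hστ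
  set K := (1 : Matrix n n ℂ) ⊗ₖ σ with hK
  set L := (1 : Matrix n n ℂ) ⊗ₖ τ with hL
  have hKh : Kᴴ = K := by rw [hK, Matrix.conjTranspose_kronecker, hσ, Matrix.conjTranspose_one]
  have hLh : Lᴴ = L := by rw [hL, Matrix.conjTranspose_kronecker, hτ, Matrix.conjTranspose_one]
  have hKL : K * L = 1 := by
    rw [hK, hL, ← Matrix.mul_kronecker_mul, hστ, Matrix.one_mul, Matrix.one_kronecker_one]
  have hLK : L * K = 1 := mul_eq_one_comm.1 hKL
  have hZ'p : (L * Z₁ * L).PosSemidef := by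
    have := hZ₁p.mul_mul_conjTranspose_same L
    rwa [hLh] at this
  have hZ'1 : L * Z₁ * L - 1 = L * (Z - (1 : Matrix n n ℂ) ⊗ₖ ρ) * L := by
    have h1 : L * ((1 : Matrix n n ℂ) ⊗ₖ ρ₁) * L = 1 := by
      rw [hL, ← Matrix.mul_kronecker_mul, ← Matrix.mul_kronecker_mul, ← hσσ, ← Matrix.mul_assoc, hτσ,
        Matrix.one_mul σ, hστ, Matrix.one_mul, Matrix.one_mul, Matrix.one_kronecker_one]
    rw [← hdiff, Matrix.mul_sub, Matrix.sub_mul, h1]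
  set v := K *ᵥ tensorVec V with hv
  have hvT : v = tensorVec (V * σᵀ) := one_kronecker_mulVec_tensorVec _ _
  set t := (star (tensorVec V) ⬝ᵥ (Z₁ *ᵥ tensorVec V)).re with ht
  have htv : star v ⬝ᵥ ((L * Z₁ * L) *ᵥ v) = t := by
    have h1 : (L * Z₁ * L) *ᵥ v = L *ᵥ (Z₁ *ᵥ tensorVec V) := by
      rw [hv, Matrix.mulVec_mulVec, Matrix.mulVec_mulVec, Matrix.mul_assoc (L * Z₁), hLK,
        Matrix.mul_one]
    rw [h1, hv, Matrix.star_mulVec, hKh, ← Matrix.dotProduct_mulVec, Matrix.mulVec_mulVec, hKL,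
      Matrix.one_mulVec]
    refine Complex.ext rfl ?_
    exact hZ₁p.isHermitian.im_star_dotProduct_mulVec_self _
  have htr : ρ₁.trace.re = ρ.trace.re + ε * Fintype.card n := by
    rw [hρ₁, Matrix.trace_add, Matrix.trace_smul, Matrix.trace_one]
    simp
  have htr0 : 0 ≤ ρ₁.trace.re := (Complex.le_def.1 hρ₁p.posSemidef.trace_nonneg).1
  have htlt : ρ₁.trace.re < t := by
    rw [htr]
    exact hεlt.trans_le hval
  have ht0 : 0 < t := htr0.trans_lt htlt
  -- Put Z' = L Z₁ L and t = ⟨v|Z'|v⟩. The normalised image Z'v/√t satisfies |M⟩⟨M| ≤ Z' and ⟨M|v⟩ =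
  -- √t.
  let M : Matrix n n ℂ := Matrix.of fun x c => (((√t)⁻¹ : ℂ) • ((L * Z₁ * L) *ᵥ v)) (x, c)
  have hM : tensorVec M = ((√t)⁻¹ : ℂ) • ((L * Z₁ * L) *ᵥ v) := rfl
  have hfeas := isFeasible_lift d hS (M := M) (Z := L * Z₁ * L) (fun c c' => by
      rw [hZ'1]
      exact slice_conj_one_kronecker_mem _ _ hperp c c')
    (by rw [hM]; exact posSemidef_sub_vecMulVec hZ'p v htv ht0)
  have hWp : 0 ≤ M * Mᴴ :=
    Matrix.nonneg_iff_posSemidef.2 (Matrix.posSemidef_self_mul_conjTranspose M)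
  refine ⟨M * Mᴴ, hWp, theta_le (d.Psi_nonneg hWp) (d.lift_mul_conjTranspose M) zero_le_one hfeas,
    ?_⟩
  have hinner : ((Vᴴ * M)ᴴ * σᵀ).trace = (√t : ℂ) := by
    have h1 : (Vᴴ * M)ᴴ * σᵀ = Mᴴ * (V * σᵀ) := by
      rw [Matrix.conjTranspose_mul, Matrix.conjTranspose_conjTranspose, Matrix.mul_assoc]
    have h2 : star ((L * Z₁ * L) *ᵥ v) ⬝ᵥ v = t := by
      rw [Matrix.star_mulVec, hZ'p.isHermitian.eq, ← Matrix.dotProduct_mulVec, htv]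
    rw [h1, ← star_tensorVec_dotProduct, ← hvT, hM, star_smul, smul_dotProduct, h2, smul_eq_mul]
    have h3 : (√t)⁻¹ * t = √t := by
      rw [inv_mul_eq_div, Real.div_sqrt]
    have h4 : star ((√t : ℂ)⁻¹) = (((√t)⁻¹ : ℝ) : ℂ) := by
      simp
    rw [h4, ← Complex.ofReal_mul, h3]
  -- Splitting ⟨M|v⟩ as the pairing of Vᴴ M with σᵀ gives t ≤ Tr(M Mᴴ W') Tr ρ₁, while Tr ρ₁ < t.
  have hcs := norm_sq_trace_conjTranspose_mul_le (Vᴴ * M) σᵀ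
  have h1 : ((Vᴴ * M)ᴴ * (Vᴴ * M)).trace = (M * Mᴴ * W').trace := by
    rw [Matrix.conjTranspose_mul, Matrix.conjTranspose_conjTranspose, ← hVV, Matrix.mul_assoc M,
      Matrix.trace_mul_comm M]
    simp only [Matrix.mul_assoc]
  have h2 : ((σᵀ)ᴴ * σᵀ).trace = ρ₁.trace := by
    rw [Matrix.conjTranspose_transpose_eq_transpose_conjTranspose, ← Matrix.transpose_mul, Matrix.trace_transpose, hσ, hσσ]
  rw [hinner, h1, h2, Complex.norm_real, Real.norm_eq_abs, sq_abs, Real.sq_sqrt ht0.le] at hcs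
  by_contra hle
  nlinarith [not_lt.1 hle]

/-- The pairing of an operator over the complement with an operator over the graph is controlled by
their partial traces. -/
theorem trace_amp_mul_le [DecidableEq b] (d : BlockDecomposition S₀) (hS : IsS0Graph S₀ S)
    {Y₁ : Matrix (n × b) (n × b) ℂ} {Y₂ : Matrix (n × (d.Idx × b)) (n × (d.Idx × b)) ℂ} {μ : ℝ}
    (hY₁ : ∀ c c', slice Y₁ c c' ∈ compl S₀ S) (hp₁ : Y₁.PosSemidef)
    (hY₂ : ∀ c c', slice Y₂ c c' ∈ S) (hp₂ : Y₂.PosSemidef)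
    (hμ : ((μ : ℂ) • (1 : Matrix (d.Idx × b) (d.Idx × b) ℂ) - traceLeft Y₂).PosSemidef) :
    (Y₁ * ((amp b (d.scaledUnit fun i => √(d.q i) / d.p i))ᴴ * Y₂ *
      amp b (d.scaledUnit fun i => √(d.q i) / d.p i))).trace.re ≤ μ * Y₁.trace.re := by
  set g := d.scaledUnit fun i => √(d.q i) / d.p i with hg
  set h := d.scaledUnit fun i => (√(d.p i))⁻¹ with hh
  set G := amp b g with hG
  set H := amp b h with hH
  -- Both take the S₀-component of every slice: R with the weights 1/q of the orthogonal projection,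
  -- R' with weights 1/p.
  let R : Matrix (n × b) (n × b) ℂ := Matrix.of fun x y => d.proj (slice Y₁ x.2 y.2) x.1 y.1
  let R' : Matrix (n × b) (n × b) ℂ := Matrix.of fun x y =>
    d.comp (fun i => (((√(d.p i))⁻¹ : ℝ) : ℂ) ^ 2) (slice Y₁ x.2 y.2) x.1 y.1
  have hR : ∀ c c', slice R c c' = d.proj (slice Y₁ c c') := fun c c' => rfl
  have hR' : ∀ c c', slice R' c c' =
    d.comp (fun i => (((√(d.p i))⁻¹ : ℝ) : ℂ) ^ 2) (slice Y₁ c c') := fun c c' => rfl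
  set τ := traceLeft (H * Y₁ * Hᴴ) with hτ
  have hτp : τ.PosSemidef := posSemidef_traceLeft (hp₁.mul_mul_conjTranspose_same H)
  set T := (1 : Matrix n n ℂ) ⊗ₖ τ with hT
  have hTp : T.PosSemidef := Matrix.PosSemidef.one.kronecker hτp
  have hsq : ∀ i, (√(d.p i : ℝ))⁻¹ * (√(d.p i : ℝ))⁻¹ = (d.p i : ℝ)⁻¹ := fun i => by
    rw [← mul_inv, Real.mul_self_sqrt (Nat.cast_nonneg _)]
  have hHH : Hᴴ * H = 1 := by
    rw [hH, amp_conjTranspose_mul_amp, d.sum_conjTranspose_scaledUnit_mul hsq,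
      Matrix.one_kronecker_one]
  -- T = I ⊗ τ preserves the range of the isometry H and acts there as R'.
  have hTH : T * H = H * R' := by
    refine slice_ext ?_
    rintro ⟨k, c⟩ c'
    rw [slice_mul_amp, slice_amp_mul, hR', ← d.sum_trace_smul_scaledUnit]
    refine Finset.sum_congr rfl fun l _ => ?_
    rw [hT, slice_kronecker, hτ, traceLeft_apply, slice_mul_amp_conjTranspose, slice_amp_mul,
      Matrix.smul_mul, Matrix.one_mul]
  -- The weights √q/p of G are chosen for this: (√q/p)² · 1/q = 1/p · 1/p, so G R Gᴴ = H R' Hᴴ.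
  have hGR : G * R * Gᴴ = T * (H * Hᴴ) := by
    rw [← Matrix.mul_assoc T, hTH]
    refine slice_ext ?_
    rintro ⟨k, c⟩ ⟨l, c'⟩
    rw [slice_mul_amp_conjTranspose, slice_amp_mul, slice_mul_amp_conjTranspose, slice_amp_mul, hR,
      hR']
    refine d.scaledUnit_mul_comp_mul (fun i => ?_) _ k l
    have h1 : (√(d.q i : ℝ) / d.p i) ^ 2 * (d.q i : ℝ)⁻¹ =
        ((√(d.p i : ℝ))⁻¹) ^ 2 * ((√(d.p i : ℝ))⁻¹) ^ 2 := by
      have hq : (d.q i : ℝ) ≠ 0 := by exact_mod_cast (d.q_pos i).ne'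
      have hp : (d.p i : ℝ) ≠ 0 := by exact_mod_cast (d.p_pos i).ne'
      rw [sq (√(d.p i : ℝ))⁻¹, hsq, div_pow, Real.sq_sqrt (Nat.cast_nonneg _)]
      field_simp
    have h2 := congrArg (fun x : ℝ => (x : ℂ)) h1
    push_cast at h2 ⊢
    exact h2
  set P := H * Hᴴ with hP
  have hPh : Pᴴ = P := by rw [hP, Matrix.conjTranspose_mul, Matrix.conjTranspose_conjTranspose]
  have hPP : P * P = P := by
    rw [hP, Matrix.mul_assoc, ← Matrix.mul_assoc Hᴴ, hHH, Matrix.one_mul]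
  have hR'h : R'ᴴ = R' := by
    have h1 : R' = Hᴴ * T * H := by
      rw [Matrix.mul_assoc, hTH, ← Matrix.mul_assoc, hHH, Matrix.one_mul]
    rw [h1, Matrix.conjTranspose_mul, Matrix.conjTranspose_mul, Matrix.conjTranspose_conjTranspose,
      hTp.isHermitian.eq, Matrix.mul_assoc]
  -- T P = H R' Hᴴ is Hermitian, so T commutes with the projection P; hence T P ≤ T.
  have hPT : P * T = T * P := by
    have h1 : (T * P)ᴴ = T * P := by
      rw [hP, ← Matrix.mul_assoc, hTH, Matrix.conjTranspose_mul, Matrix.conjTranspose_mul,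
        Matrix.conjTranspose_conjTranspose, hR'h, Matrix.mul_assoc]
    rw [← h1, Matrix.conjTranspose_mul, hTp.isHermitian.eq, hPh]
  have hTP : (T - T * P).PosSemidef := by
    have h1 := hTp.mul_mul_conjTranspose_same (1 - P)
    convert h1 using 1
    rw [Matrix.conjTranspose_sub, hPh, Matrix.conjTranspose_one, Matrix.sub_mul, Matrix.mul_sub,
      Matrix.one_mul, Matrix.mul_one, Matrix.sub_mul, hPT, Matrix.mul_assoc, hPP]
    simp
  -- The slices of Gᴴ Y₂ G lie in S, so the S^⊥ part of each slice of Y₁ drops out.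
  have hproj : (Y₁ * (Gᴴ * Y₂ * G)).trace = (R * (Gᴴ * Y₂ * G)).trace := by
    rw [← sub_eq_zero, ← Matrix.trace_sub, ← Matrix.sub_mul, trace_mul_eq_sum_slice]
    refine Finset.sum_eq_zero fun c _ => Finset.sum_eq_zero fun c' _ => ?_
    have h1 : slice (Gᴴ * Y₂ * G) c' c ∈ S := by
      rw [slice_mul_amp]
      refine S.sum_mem fun l _ => ?_
      rw [slice_amp_conjTranspose_mul, Matrix.sum_mul]
      exact S.sum_mem fun k _ => hS.mul_mul_mem (star_mem (d.scaledUnit_mem _ k)) (hY₂ _ _)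
        (d.scaledUnit_mem _ l)
    have h2 := sub_proj_mem_perp d hS (hY₁ c c') _ (hS.conjTranspose_mem h1)
    rwa [Matrix.conjTranspose_conjTranspose, Matrix.trace_mul_comm] at h2
  have hcyc : (R * (Gᴴ * Y₂ * G)).trace = (T * P * Y₂).trace := by
    rw [← hGR, Matrix.mul_assoc Gᴴ, ← Matrix.mul_assoc R, Matrix.trace_mul_comm]
    simp only [Matrix.mul_assoc]
    rw [Matrix.trace_mul_comm]
    simp only [Matrix.mul_assoc]
  have h1 := (Complex.le_def.1 (trace_mul_nonneg hTP hp₂)).1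
  have h2 := (Complex.le_def.1 (trace_mul_nonneg hτp hμ)).1
  have h3 : τ.trace = Y₁.trace := by
    rw [hτ, trace_traceLeft, Matrix.trace_mul_cycle, hHH, Matrix.one_mul]
  rw [Matrix.sub_mul, Matrix.trace_sub, hT, trace_one_kronecker_mul, ← hT] at h1
  rw [Matrix.mul_sub, Matrix.trace_sub, Matrix.mul_smul, Matrix.mul_one, Matrix.trace_smul, h3,
    smul_eq_mul, Complex.sub_re, Complex.re_ofReal_mul] at h2
  rw [hproj, hcyc]
  simp only [Complex.zero_re, Complex.sub_re] at h1 h2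
  linarith

/-- With s = Tr(M Mᴴ V Vᴴ), one trace is at least s² and at most μ l s; cancelling s gives the
bound. -/
theorem trace_mul_re_le [DecidableEq b] (d : BlockDecomposition S₀) (hS : IsS0Graph S₀ S) {b' : Type*} [Fintype b']
    [DecidableEq b'] {V : Matrix n b' ℂ} {M : Matrix n b ℂ} {l μ : ℝ} (hl : 0 ≤ l) (hμ : 0 ≤ μ)
    (hV : IsFeasible (compl S₀ S) V l) (hM : IsFeasible S (d.lift M) μ) :
    (M * Mᴴ * (V * Vᴴ)).trace.re ≤ l * μ := by
  obtain ⟨Y₁, hY₁, hl₁, hYV⟩ := hV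
  obtain ⟨Y₂, hY₂, hl₂, hYM⟩ := hM
  -- I ⊗ C maps the vector of V to that of V Vᴴ M, whose inner product with the vector of M is s;
  -- moreover Tr(Cᴴ C) = s.
  set C := (Vᴴ * M)ᵀ with hC
  set K := (1 : Matrix n n ℂ) ⊗ₖ C with hK
  have hKh : Kᴴ = (1 : Matrix n n ℂ) ⊗ₖ Cᴴ := by
    rw [hK, Matrix.conjTranspose_kronecker, Matrix.conjTranspose_one]
  have hp₁ : Y₁.PosSemidef := by
    simpa using hYV.add (Matrix.posSemidef_vecMulVec_self_star (tensorVec V))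
  have hp₂ : Y₂.PosSemidef := by
    simpa using hYM.add (Matrix.posSemidef_vecMulVec_self_star (tensorVec (d.lift M)))
  set G := amp b (d.scaledUnit fun i => √(d.q i) / d.p i) with hG
  set s := (M * Mᴴ * (V * Vᴴ)).trace.re with hs
  have hsC : ((s : ℝ) : ℂ) = (Mᴴ * (V * Vᴴ * M)).trace := by
    have h1 : (Mᴴ * (V * Vᴴ * M)).trace = (M * Mᴴ * (V * Vᴴ)).trace := by
      rw [Matrix.trace_mul_comm, Matrix.mul_assoc, Matrix.trace_mul_comm]
    have h2 := (Complex.le_def.1 (trace_mul_nonneg (Matrix.posSemidef_self_mul_conjTranspose M)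
      (Matrix.posSemidef_self_mul_conjTranspose V))).2
    rw [h1]
    exact Complex.ext rfl h2
  have hs0 : 0 ≤ s := (Complex.le_def.1 (trace_mul_nonneg
    (Matrix.posSemidef_self_mul_conjTranspose M) (Matrix.posSemidef_self_mul_conjTranspose V))).1
  have hupper := trace_amp_mul_le d hS (Y₁ := K * Y₁ * Kᴴ) (fun c c' => by
    rw [hKh]
    exact slice_conj_one_kronecker_mem _ _ hY₁ c c') (hp₁.mul_mul_conjTranspose_same K) hY₂ hp₂ hl₂
  have htr : (K * Y₁ * Kᴴ).trace.re ≤ l * s := by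
    have h1 : (K * Y₁ * Kᴴ).trace = ((Cᴴ * C) * traceLeft Y₁).trace := by
      rw [← trace_traceLeft, hKh, traceLeft_conj_one_kronecker, Matrix.trace_mul_cycle]
    have h2 := (Complex.le_def.1
      (trace_mul_nonneg (Matrix.posSemidef_conjTranspose_mul_self C) hl₁)).1
    have h3 : (Cᴴ * C).trace = s := by
      rw [hsC, hC, Matrix.conjTranspose_transpose_eq_transpose_conjTranspose,
        ← Matrix.transpose_mul, Matrix.trace_transpose,
        Matrix.trace_mul_comm, Matrix.conjTranspose_mul, Matrix.conjTranspose_conjTranspose]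
      simp only [Matrix.mul_assoc]
    rw [Matrix.mul_sub, Matrix.trace_sub, ← h1, Matrix.mul_smul, Matrix.mul_one, Matrix.trace_smul,
      h3, smul_eq_mul, Complex.sub_re, Complex.re_ofReal_mul, Complex.ofReal_re,
      Complex.zero_re] at h2
    linarith
  have hlower : s ^ 2 ≤ (K * Y₁ * Kᴴ * (Gᴴ * Y₂ * G)).trace.re := by
    -- Gᴴ undoes the lift because (√q/p)(1/√q) = 1/p, so Gᴴ Y₂ G dominates |M⟩⟨M|.
    have hGM : Gᴴ *ᵥ tensorVec (d.lift M) = tensorVec M := by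
      rw [BlockDecomposition.lift, ← amp_mulVec_tensorVec, Matrix.mulVec_mulVec, hG,
        amp_conjTranspose_mul_amp, d.sum_conjTranspose_scaledUnit_mul, Matrix.one_kronecker_one,
        Matrix.one_mulVec]
      intro i
      have hq : √(d.q i : ℝ) ≠ 0 := by
        rw [Real.sqrt_ne_zero (Nat.cast_nonneg _)]
        exact_mod_cast (d.q_pos i).ne'
      field_simp
    have h1 := hYM.mul_mul_conjTranspose_same Gᴴ
    rw [Matrix.mul_sub, Matrix.sub_mul, mul_vecMulVec_mul_conjTranspose,
      Matrix.conjTranspose_conjTranspose, hGM] at h1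
    have h2 := (Complex.le_def.1 (trace_mul_nonneg (hp₁.mul_mul_conjTranspose_same K) h1)).1
    have h3 := hYV.mul_mul_conjTranspose_same K
    rw [Matrix.mul_sub, Matrix.sub_mul, mul_vecMulVec_mul_conjTranspose,
      one_kronecker_mulVec_tensorVec, hC, Matrix.transpose_transpose] at h3
    have h4 := (Complex.le_def.1 (h3.dotProduct_mulVec_nonneg (tensorVec M))).1
    have h5 : star (tensorVec M) ⬝ᵥ tensorVec (V * (Vᴴ * M)) = s := by
      rw [star_tensorVec_dotProduct, hsC, Matrix.mul_assoc V]
    have h6 : star (tensorVec (V * (Vᴴ * M))) ⬝ᵥ tensorVec M = s := by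
      have := congrArg star h5
      rwa [← Matrix.star_dotProduct_star, star_star, Complex.star_def,
        Complex.conj_ofReal] at this
    rw [Matrix.sub_mulVec, dotProduct_sub, Matrix.vecMulVec_mulVec, h6, dotProduct_smul, h5] at h4
    rw [Matrix.mul_sub, Matrix.trace_sub, trace_mul_vecMulVec_star] at h2
    simp only [Complex.zero_re, Complex.sub_re, op_smul_eq_smul, ← Complex.ofReal_mul,
      Complex.ofReal_re, smul_eq_mul] at h2 h4
    nlinarith
  rcases hs0.eq_or_lt with h0 | h0
  · rw [← h0]
    positivity
  · have h1 : s ^ 2 ≤ μ * (l * s) := hlower.trans (hupper.trans (mul_le_mul_of_nonneg_left htr hμ))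
    nlinarith

end inequalities

/-! ### Theta bodies as anti-blockers -/

section antiblocker

variable {n : Type*} [Fintype n]

theorem antiblocker_anti {C D : Set (Matrix n n ℂ)} (h : C ⊆ D) : antiblocker D ⊆ antiblocker C :=
  fun _ hB => ⟨hB.1, fun A hA => hB.2 A (h hA)⟩

theorem subset_antiblocker_antiblocker {C : Set (Matrix n n ℂ)} (hC : ∀ W ∈ C, 0 ≤ W) :
    C ⊆ antiblocker (antiblocker C) := fun W hW => ⟨hC W hW, fun B hB => by
  rw [Matrix.trace_mul_comm]
  exact hB.2 W hW⟩

theorem antiblocker_antiblocker_antiblocker {C : Set (Matrix n n ℂ)} (hC : ∀ W ∈ C, 0 ≤ W) :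
    antiblocker (antiblocker (antiblocker C)) = antiblocker C :=
  (antiblocker_anti (subset_antiblocker_antiblocker hC)).antisymm
    (subset_antiblocker_antiblocker fun _ hW => hW.1)

variable [DecidableEq n]

theorem thetaBody_eq (S : Submodule ℂ (Matrix n n ℂ)) :
    thetaBody S = antiblocker {W | 0 ≤ W ∧ theta S W ≤ 1} := by
  ext X
  refine and_congr_right fun _ => ⟨fun h W hW => ?_, fun h W hW hW1 => ?_⟩
  · rw [Matrix.trace_mul_comm]
    exact h W hW.1 hW.2
  · rw [Matrix.trace_mul_comm]
    exact h W ⟨hW, hW1⟩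

/-- The product bound gives one inclusion and the dual construction the other. -/
theorem setOf_theta_compl_le_one {S₀ : StarSubalgebra ℂ (Matrix n n ℂ)} (d : BlockDecomposition S₀)
    {S : Submodule ℂ (Matrix n n ℂ)} (hS : IsS0Graph S₀ S) :
    {W | 0 ≤ W ∧ theta (compl S₀ S) W ≤ 1} =
      antiblocker {W | 0 ≤ W ∧ theta S (d.Psi W) ≤ 1} := by
  ext W'
  refine and_congr_right fun hW' => ⟨fun h W hW => ?_, fun h => ?_⟩
  -- Feasible points are available only above the infimum, so both factors are relaxed to 1 + ε
  -- before letting ε tend to 0.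
  · have key : ∀ ε : ℝ, 0 < ε → (W * W').trace.re ≤ (1 + ε) * (1 + ε) := by
      intro ε hε
      have h1 := isFeasible_of_theta_lt hS.compl.isNCGraph.one_mem (h.trans_lt (by linarith : 1 < 1 + ε))
      have h2 := isFeasible_of_theta_lt hS.isNCGraph.one_mem (hW.2.trans_lt (by linarith : 1 < 1 + ε))
      have h3 : d.lift (CFC.sqrt W) * (d.lift (CFC.sqrt W))ᴴ =
          CFC.sqrt (d.Psi W) * (CFC.sqrt (d.Psi W))ᴴ := by
        rw [d.lift_mul_conjTranspose, sqrt_mul_conjTranspose_sqrt hW.1,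
          sqrt_mul_conjTranspose_sqrt (d.Psi_nonneg hW.1)]
      have hε' : 0 ≤ 1 + ε := by linarith
      have h4 := trace_mul_re_le d hS hε' hε' h1 (h2.congr hε' h3)
      rwa [sqrt_mul_conjTranspose_sqrt hW.1, sqrt_mul_conjTranspose_sqrt hW'] at h4
    have hlim : Filter.Tendsto (fun ε : ℝ => (1 + ε) * (1 + ε)) (nhdsWithin 0 (Set.Ioi 0))
        (nhds ((1 + 0) * (1 + 0))) :=
      Filter.Tendsto.mono_left (Continuous.tendsto (by fun_prop) 0) nhdsWithin_le_nhds
    have := ge_of_tendsto hlim (Filter.eventually_of_mem self_mem_nhdsWithin key)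
    simpa using this
  · by_contra hlt
    obtain ⟨W, hW, hW1, hW2⟩ := exists_one_lt_trace d hS hW' (not_le.1 hlt)
    exact absurd (h W ⟨hW, hW1⟩) (not_le.2 hW2)

/-- The sublevel set is itself an anti-blocker, by the identity for the complement and the
involution, and a triple anti-blocker collapses to a single one. No separate proof of convexity or
closedness is needed. -/
theorem antiblocker_thetaBody {S₀ : StarSubalgebra ℂ (Matrix n n ℂ)} (d : BlockDecomposition S₀)
    {S : Submodule ℂ (Matrix n n ℂ)} (hS : IsS0Graph S₀ S) :
    antiblocker (thetaBody S) = {W | 0 ≤ W ∧ theta S W ≤ 1} := by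
  have h := setOf_theta_compl_le_one d hS.compl
  rw [compl_compl d hS] at h
  rw [thetaBody_eq, h]
  exact antiblocker_antiblocker_antiblocker fun _ hW => hW.1

end antiblocker
end NCGraph

theorem mainTheorem5 {n : Type*} [Fintype n] [DecidableEq n]
    (S₀ : StarSubalgebra ℂ (Matrix n n ℂ)) (d : NCGraph.BlockDecomposition S₀)
    (S : Submodule ℂ (Matrix n n ℂ)) (hS : NCGraph.IsS0Graph S₀ S) :
    NCGraph.antiblocker (NCGraph.thetaBody (NCGraph.compl S₀ S)) =
      d.psiAntiblocker (NCGraph.antiblocker (NCGraph.thetaBody S)) := by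
  rw [NCGraph.BlockDecomposition.psiAntiblocker, NCGraph.antiblocker_thetaBody d hS,
    NCGraph.antiblocker_thetaBody d hS.compl, NCGraph.setOf_theta_compl_le_one d hS]
  congr 1
  ext W
  -- Membership of Ψ(W) in the sublevel set also asks for Ψ(W) ≥ 0, which is automatic for W ≥ 0.
  exact and_congr_right fun hW => (and_iff_right (d.Psi_nonneg hW)).symm
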